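/- Let $G=(V,E)$ be a (possibly infinite) simple graph with $V\neq\emptyset$, and let $|G|$ be its $1$-complex: the quotient, with the quotient topology, of the topological sum of the discrete space $V$ and of one copy $[0,1]_e$ of the unit interval for each edge $e=vw\in E$, in which $v$ is identified with $0\in[0,1]_e$ and $w$ with $1\in[0,1]_e$. In $|G|$, an arc is a homeomorphic copy of $[0,1]$, a circle is a homeomorphic copy of $S^1$, and a $\theta$-curve is a union of three arcs with the same two distinct endpoints, any two of which meet only in these endpoints. Then the following five conditions are equivalent: (1) $G$ is $3$-sac ($3$-strongly arc connected): for every list $x_1,\dots,x_m$ of $m\le 3$ distinct points of $|G|$ there is an arc in $|G|$ that contains these points in the order of the list; (2) $G$ is cyclically connected: any two (not necessarily distinct) vertices lie on a common cycle of $G$; (3) any three (not necessarily distinct) points of $|G|$ lie on a common circle or a common $\theta$-curve in $|G|$; (4) $G$ is not isomorphic to $K_2$ and $G$ is $2$-connected, i.e. $G-W$ is connected for every set $W$ of fewer than $2$ vertices (a connected graph being nonempty by convention, so that $K_1$ is not $2$-connected); (5) $G$ is $2$-cc ($2$-circle connected): any at most two points of $|G|$ lie on a common circle in $|G|$. -/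

import Mathlib

universe u

namespace SimpleGraph

variable {V : Type u}

/-- The disjoint union of the vertex set and one copy of `[0,1]` for every edge. -/
def PreComplex (G : SimpleGraph V) : Type u :=
  V ⊕ (Σ _ : G.edgeSet, unitInterval)

/-- The vertex set is discrete, and the union with the intervals is a topological sum. -/
instance (G : SimpleGraph V) : TopologicalSpace G.PreComplex :=
  letI : TopologicalSpace V := ⊥
  inferInstanceAs (TopologicalSpace (V ⊕ (Σ _ : G.edgeSet, unitInterval)))

/-- The identifications: for each edge `e` (with its two ends `e.out.1`, `e.out.2` listed in an
arbitrarily chosen order), the first end is glued to `0` and the second end to `1` in the copy of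
`[0,1]` that belongs to `e`. -/
inductive Glue (G : SimpleGraph V) : G.PreComplex → G.PreComplex → Prop
  | source (e : G.edgeSet) : Glue G (Sum.inl (Quot.out e.1).1) (Sum.inr ⟨e, 0⟩)
  | target (e : G.edgeSet) : Glue G (Sum.inl (Quot.out e.1).2) (Sum.inr ⟨e, 1⟩)

/-- The 1-complex `|G|` of a graph `G`: the quotient by the equivalence relation generated by
`Glue`. -/
def OneComplex (G : SimpleGraph V) : Type u := Quot G.Glue

/-- `|G|` carries the quotient topology. -/
instance (G : SimpleGraph V) : TopologicalSpace G.OneComplex :=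
  inferInstanceAs (TopologicalSpace (Quot G.Glue))

/-- Every two vertices (distinct or not) lie on a cycle of the graph. -/
def IsCyclicallyConnected (G : SimpleGraph V) : Prop :=
  ∀ v w : V, ∃ (a : V) (c : G.Walk a a), c.IsCycle ∧ v ∈ c.support ∧ w ∈ c.support

/-- `G - W` is connected (in particular nonempty) for every set `W` of fewer than `k` vertices. -/
def IsKConnected (G : SimpleGraph V) (k : ℕ) : Prop :=
  ∀ W : Set V, W.encard < k → (G.induce Wᶜ).Connected

end SimpleGraph

section Curves

variable {X : Type u} [TopologicalSpace X]

/-- A circle (simple closed curve) in `X`. -/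
def IsCircleIn (C : Set X) : Prop := Nonempty (C ≃ₜ Circle)

/-- A θ-curve in `X`: the union of three arcs with the same two end points `a ≠ b`, any two of
which have only these end points in common. -/
def IsThetaCurveIn (T : Set X) : Prop :=
  ∃ (a b : X) (p : Fin 3 → unitInterval → X), a ≠ b ∧
    (∀ i, Topology.IsEmbedding (p i) ∧ p i 0 = a ∧ p i 1 = b) ∧
    (∀ i j, i ≠ j → Set.range (p i) ∩ Set.range (p j) = {a, b}) ∧
    T = ⋃ i, Set.range (p i)

variable (X)

/-- `n`-strongly arc connected: for every list of at most `n` (distinct) points of `X` there is an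
arc, i.e. an embedded copy of `[0,1]`, which meets these points in the order of the list. -/
def IsNSac (n : ℕ) : Prop :=
  ∀ m ≤ n, ∀ x : Fin m → X, Function.Injective x →
    ∃ α : unitInterval → X, Topology.IsEmbedding α ∧
      ∃ t : Fin m → unitInterval, StrictMono t ∧ ∀ i, α (t i) = x i

/-- `n`-circle connected: any at most `n` points of `X` lie on a circle in `X`. -/
def IsNCc (n : ℕ) : Prop :=
  ∀ S : Finset X, S.card ≤ n → ∃ C : Set X, IsCircleIn C ∧ (S : Set X) ⊆ C

end Curves

/-! All five conditions say that `G` is a block: it has at least three vertices, and no vertex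
separates two others. For a nonempty vertex set, `isBlock_iff_isKConnected` identifies this with
(4). `isBlock_iff_isCyclicallyConnected` identifies it with (2), the substantial direction being
Whitney's argument: a cycle through `u` and `w` is rerouted to reach a neighbour `v` of `w`
(`OnCommonCycle.of_adj`), and one moves along a walk.

From blocks to topology: finitely many given points of `|G|` become vertices after edges are
subdivided. Subdivision preserves blocks (`IsBlock.subdivide`) and leaves the space unchanged, so it
is enough to treat vertices of a block that is drawn on the space by arcs. A cycle through two
vertices is drawn as a circle. The fan lemma `IsBlock.exists_fan` does the rest: a fan from the
middle vertex to the two others is an arc through three vertices in the prescribed order, and a fan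
from a third vertex to a cycle through two others completes the cycle to a θ-curve.

From topology to blocks: each of (1), (3), (5) makes `|G|` infinite and shows that no point of it
separates two others (`NoCutPoints`). If `G` had a separating vertex or at most two vertices, then
either `|G|` would be a single point, or some continuous real function on `|G|` would change sign
while having at most one zero. The intermediate value theorem along a path that avoids this zero
gives a contradiction. -/

namespace SimpleGraph

/-! ### Blocks, cycles and 2-connectedness. -/

variable {V : Type u} {G : SimpleGraph V}

/-- A graph with at least three vertices from which no vertex can be deleted so as to separate
two others. -/
structure IsBlock (G : SimpleGraph V) : Prop where
  exists_third : ∀ a b : V, ∃ c, c ≠ a ∧ c ≠ b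
  exists_avoiding : ∀ w a b : V, a ≠ w → b ≠ w → ∃ p : G.Walk a b, w ∉ p.support

/-- Two vertices lie on a common cycle. -/
def OnCommonCycle (G : SimpleGraph V) (v w : V) : Prop :=
  ∃ (a : V) (c : G.Walk a a), c.IsCycle ∧ v ∈ c.support ∧ w ∈ c.support

/-- Two paths with the same ends that share no inner vertices and no edges. -/
structure IsPathPair {a b : V} (p q : G.Walk a b) : Prop where
  left : p.IsPath
  right : q.IsPath
  inter : ∀ x ∈ p.support, x ∈ q.support → x = a ∨ x = b
  edges : ∀ e ∈ p.edges, e ∉ q.edges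

theorem IsPathPair.symm {a b : V} {p q : G.Walk a b} (h : IsPathPair p q) : IsPathPair q p :=
  ⟨h.right, h.left, fun x hx hy => h.inter x hy hx, fun e he hf => h.edges e hf he⟩

namespace Walk

theorem IsPath.ne_of_mem_tail {a b x : V} {p : G.Walk a b} (hp : p.IsPath)
    (hx : x ∈ p.support.tail) : x ≠ a := by
  have h := hp.support_nodup
  rw [← cons_tail_support] at h
  rintro rfl
  exact (List.nodup_cons.1 h).1 hx

theorem mem_tail_of_ne {a b x : V} {p : G.Walk a b} (hx : x ∈ p.support) (h : x ≠ a) :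
    x ∈ p.support.tail := by
  rw [← cons_tail_support] at hx
  exact (List.mem_cons.1 hx).resolve_left h

/-- Two distinct vertices of a cycle divide it into two paths. -/
theorem IsCycle.exists_isPathPair {a v w : V} {c : G.Walk a a} (hc : c.IsCycle)
    (hv : v ∈ c.support) (hw : w ∈ c.support) (hvw : v ≠ w) :
    ∃ p q : G.Walk v w, IsPathPair p q ∧
      ∀ x, x ∈ c.support ↔ x ∈ p.support ∨ x ∈ q.support := by
  classical
  obtain ⟨d, hd, hdc⟩ : ∃ d : G.Walk v v, d.IsCycle ∧ ∀ x, x ∈ d.support ↔ x ∈ c.support :=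
    ⟨c.rotate v hv, (isCycle_rotate hv).2 hc, fun x => mem_support_rotate_iff c v hv⟩
  have hw' : w ∈ d.support := (hdc w).2 hw
  have hsp := d.take_spec hw'
  have hnil : ¬ (d.takeUntil w hw').Nil := fun h => hvw h.eq
  have hr : (d.dropUntil w hw').IsPath := by
    have := hd
    rw [← hsp] at this
    exact this.isPath_of_append_right hnil
  refine ⟨d.takeUntil w hw', (d.dropUntil w hw').reverse,
    ⟨hd.isPath_takeUntil hw', hr.reverse, ?_, ?_⟩, ?_⟩
  · intro x hx hy
    by_contra! hne
    rw [support_reverse, List.mem_reverse] at hy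
    have hn := hd.support_nodup
    rw [← hsp, tail_support_append] at hn
    exact (List.nodup_append.1 hn).2.2 x (mem_tail_of_ne hx hne.1) x (mem_tail_of_ne hy hne.2) rfl
  · intro e he hf
    rw [edges_reverse, List.mem_reverse] at hf
    exact hd.isTrail.disjoint_edges_takeUntil_dropUntil hw' he hf
  · intro x
    rw [← hdc, support_reverse, List.mem_reverse, ← mem_support_append_iff, hsp]

end Walk

/-- Two internally disjoint paths with the same distinct ends form a cycle. -/
theorem IsPathPair.isCycle {a b : V} {p q : G.Walk a b} (h : IsPathPair p q) (hab : a ≠ b) :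
    (p.append q.reverse).IsCycle := by
  rw [Walk.isCycle_def]
  refine ⟨?_, ?_, ?_⟩
  · rw [Walk.isTrail_def, Walk.edges_append, List.nodup_append]
    refine ⟨h.left.isTrail.edges_nodup, h.right.reverse.isTrail.edges_nodup, ?_⟩
    rintro e he f hf rfl
    rw [Walk.edges_reverse, List.mem_reverse] at hf
    exact h.edges e he hf
  · intro hn
    have hl := congrArg Walk.length hn
    rw [Walk.length_append, Walk.length_nil] at hl
    exact hab (Walk.eq_of_length_eq_zero (p := p) (by omega))
  · rw [Walk.tail_support_append, List.nodup_append]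
    refine ⟨h.left.support_nodup.tail, h.right.reverse.support_nodup.tail, ?_⟩
    rintro x hx y hy rfl
    have h1 := h.left.ne_of_mem_tail hx
    have h2 := h.right.reverse.ne_of_mem_tail hy
    have hy' := List.mem_of_mem_tail hy
    rw [Walk.support_reverse, List.mem_reverse] at hy'
    exact (h.inter x (List.mem_of_mem_tail hx) hy').elim h1 h2

theorem IsPathPair.onCommonCycle {a b x y : V} {p q : G.Walk a b} (h : IsPathPair p q)
    (hab : a ≠ b) (hx : x ∈ p.support ∨ x ∈ q.support) (hy : y ∈ p.support ∨ y ∈ q.support) :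
    G.OnCommonCycle x y := by
  refine ⟨a, _, h.isCycle hab, ?_, ?_⟩ <;>
    rwa [Walk.mem_support_append_iff, Walk.support_reverse, List.mem_reverse]

/-- A walk into a set contains a path that meets the set only in its last vertex. -/
theorem Walk.exists_isPath_first_mem {z t : V} (p : G.Walk z t) (S : Set V) (ht : t ∈ S) :
    ∃ (s : V) (q : G.Walk z s), q.IsPath ∧ s ∈ S ∧ (∀ x ∈ q.support, x ∈ p.support) ∧
      ∀ x ∈ q.support, x ∈ S → x = s := by
  classical
  suffices H : ∃ (s : V) (q : G.Walk z s), s ∈ S ∧ (∀ x ∈ q.support, x ∈ p.support) ∧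
      ∀ x ∈ q.support, x ∈ S → x = s by
    obtain ⟨s, q, hs, hq, hx⟩ := H
    exact ⟨s, q.bypass, q.bypass_isPath, hs,
      fun x hxq => hq x (q.support_bypass_subset_support hxq),
      fun x hxq => hx x (q.support_bypass_subset_support hxq)⟩
  induction p with
  | nil => exact ⟨_, .nil, ht, by simp, by simp⟩
  | @cons a b c h p ih =>
    by_cases ha : a ∈ S
    · exact ⟨a, .nil, ha, by simp, by simp⟩
    · obtain ⟨s, q, hs, hq, hx⟩ := ih ht
      refine ⟨s, .cons h q, hs, ?_, ?_⟩
      · intro x hxq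
        rw [support_cons, List.mem_cons] at hxq ⊢
        exact hxq.imp id (hq x)
      · intro x hxq hxS
        rw [support_cons, List.mem_cons] at hxq
        rcases hxq with rfl | hxq
        · exact absurd hxS ha
        · exact hx x hxq hxS

/-- No edge of a walk that meets a set in at most one vertex has both ends in the set. -/
theorem Walk.not_mem_edges_of_forall_eq {z t s : V} {P : G.Walk z t} {S : Set V}
    (hP : ∀ x ∈ P.support, x ∈ S → x = s) {e : Sym2 V} (he : e ∈ P.edges)
    (hS : ∀ x ∈ e, x ∈ S) : False := by
  induction e with
  | _ x y =>
    have h1 := hP x (P.fst_mem_support_of_mem_edges he) (hS x (by simp))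
    have h2 := hP y (P.snd_mem_support_of_mem_edges he) (hS y (by simp))
    exact (P.adj_of_mem_edges he).ne (h1.trans h2.symm)

theorem Walk.mem_support_of_mem_edge {a b x : V} {p : G.Walk a b} {e : Sym2 V} (he : e ∈ p.edges)
    (hx : x ∈ e) : x ∈ p.support := by
  induction e with
  | _ y z =>
    rcases Sym2.mem_iff.1 hx with rfl | rfl
    · exact p.fst_mem_support_of_mem_edges he
    · exact p.snd_mem_support_of_mem_edges he

/-- The ends of an edge of a block are connected without that edge. -/
theorem IsBlock.reachable_deleteEdges (hG : G.IsBlock) {u v : V} (h : G.Adj u v) :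
    (G.deleteEdges {s(u, v)}).Reachable u v := by
  obtain ⟨c, hcu, hcv⟩ := hG.exists_third u v
  obtain ⟨p, hp⟩ := hG.exists_avoiding v u c h.ne hcv
  obtain ⟨q, hq⟩ := hG.exists_avoiding u c v hcu h.ne'
  -- The detour through `c` cannot use the edge `uv`, because its first half misses `v` and its
  -- second half misses `u`.
  refine ⟨(p.append q).toDeleteEdges _ ?_⟩
  rintro e he rfl
  rw [Walk.edges_append, List.mem_append] at he
  rcases he with he | he
  · exact hp (p.snd_mem_support_of_mem_edges he)
  · exact hq (q.fst_mem_support_of_mem_edges he)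

theorem IsBlock.onCommonCycle_of_adj (hG : G.IsBlock) {u v : V} (h : G.Adj u v) :
    G.OnCommonCycle u v := by
  obtain ⟨a, c, hc, he⟩ := adj_and_reachable_delete_edges_iff_exists_cycle.1
    ⟨h, hG.reachable_deleteEdges h⟩
  exact ⟨a, c, hc, c.fst_mem_support_of_mem_edges he, c.snd_mem_support_of_mem_edges he⟩

/-- Replacing one of two paths between `w` and `x` by a path through a neighbour `v` of `w`. -/
theorem IsPathPair.onCommonCycle_of_detour {u v w x : V} {p q : G.Walk w x}
    (h : IsPathPair p q) (hu : u ∈ p.support) (hwv : G.Adj w v)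
    (hv : v ∉ p.support) {P : G.Walk v x} (hP : P.IsPath) (hw : w ∉ P.support)
    (hPS : ∀ y ∈ P.support, y ∈ p.support → y = x) : G.OnCommonCycle u v := by
  have hwx : w ≠ x := by rintro rfl; exact hw P.end_mem_support
  have key : IsPathPair p (Walk.cons hwv P) := by
    refine ⟨h.left, hP.cons hw, ?_, ?_⟩
    · intro y hy hy'
      rw [Walk.support_cons, List.mem_cons] at hy'
      exact hy'.imp id fun h' => hPS y h' hy
    · intro e he hf
      rw [Walk.edges_cons, List.mem_cons] at hf
      rcases hf with rfl | hf
      · exact hv (p.snd_mem_support_of_mem_edges he)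
      · exact Walk.not_mem_edges_of_forall_eq (S := {y | y ∈ p.support}) hPS hf
          fun y hy => Walk.mem_support_of_mem_edge he hy
  exact key.onCommonCycle hwx (.inl hu) (.inr (by simp))

/-- If `v` is off the cycle, follow a walk from `v` to `u` that avoids `w` until it first hits the
cycle, at `x`. One of the two paths of the cycle between `w` and `x` contains `u`; the edge `wv` and
the path from `v` to `x` replace the other one. -/
theorem OnCommonCycle.of_adj (hG : G.IsBlock) {u v w : V} (h : G.OnCommonCycle u w)
    (hwv : G.Adj w v) (huw : u ≠ w) : G.OnCommonCycle u v := by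
  obtain ⟨a, c, hc, hu, hw⟩ := h
  by_cases hv : v ∈ c.support
  · exact ⟨a, c, hc, hu, hv⟩
  obtain ⟨p, hp⟩ := hG.exists_avoiding w v u hwv.ne' huw
  obtain ⟨x, P, hP, hx, hPp, hPS⟩ := p.exists_isPath_first_mem {y | y ∈ c.support} hu
  have hwP : w ∉ P.support := fun h => hp (hPp w h)
  have hwx : w ≠ x := by rintro rfl; exact hwP P.end_mem_support
  obtain ⟨q, r, hqr, hcqr⟩ := hc.exists_isPathPair hw hx hwx
  rcases (hcqr u).1 hu with h | h
  · exact hqr.onCommonCycle_of_detour h hwv (fun h' => hv ((hcqr v).2 (.inl h'))) hP hwP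
      fun y hy hy' => hPS y hy ((hcqr y).2 (.inl hy'))
  · exact hqr.symm.onCommonCycle_of_detour h hwv (fun h' => hv ((hcqr v).2 (.inr h'))) hP hwP
      fun y hy hy' => hPS y hy ((hcqr y).2 (.inr hy'))

/-- Connectedness is not part of the definition of a block; it comes from avoiding a third vertex.
-/
theorem IsBlock.exists_walk (hG : G.IsBlock) (a b : V) : Nonempty (G.Walk a b) := by
  obtain ⟨c, hca, hcb⟩ := hG.exists_third a b
  exact (hG.exists_avoiding c a b hca.symm hcb.symm).nonempty

/-- Any two distinct vertices of a block lie on a common cycle. -/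
theorem IsBlock.onCommonCycle_of_ne (hG : G.IsBlock) {u v : V} (h : u ≠ v) :
    G.OnCommonCycle u v := by
  obtain ⟨p⟩ := hG.exists_walk v u
  induction p with
  | nil => exact absurd rfl h
  | @cons v w u hvw p ih =>
    by_cases huw : u = w
    · subst huw
      exact hG.onCommonCycle_of_adj hvw.symm
    · exact (ih huw).of_adj hG hvw.symm huw

theorem IsBlock.exists_isPathPair (hG : G.IsBlock) {u v : V} (h : u ≠ v) :
    ∃ p q : G.Walk u v, IsPathPair p q := by
  obtain ⟨a, c, hc, hu, hv⟩ := hG.onCommonCycle_of_ne h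
  obtain ⟨p, q, hpq, -⟩ := hc.exists_isPathPair hu hv h
  exact ⟨p, q, hpq⟩

theorem IsBlock.isCyclicallyConnected (hG : G.IsBlock) : G.IsCyclicallyConnected := by
  intro v w
  by_cases h : v = w
  · subst h
    obtain ⟨u, hu, -⟩ := hG.exists_third v v
    obtain ⟨a, c, hc, hv, -⟩ := hG.onCommonCycle_of_ne hu.symm
    exact ⟨a, c, hc, hv, hv⟩
  · exact hG.onCommonCycle_of_ne h

/-- A cycle has at least three vertices. It also provides two internally disjoint paths between two
of its vertices, and a vertex other than these two lies on at most one of the paths. -/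
theorem IsCyclicallyConnected.isBlock (hG : G.IsCyclicallyConnected) : G.IsBlock := by
  classical
  refine ⟨fun a b => ?_, fun w a b ha hb => ?_⟩
  · obtain ⟨d, c, hc, -, -⟩ := hG a b
    by_contra! H
    have h1 : c.support.tail.toFinset ⊆ {a, b} := by
      intro x _
      rw [Finset.mem_insert, Finset.mem_singleton]
      by_contra! hx
      exact hx.2 (H x hx.1)
    have h2 := (Finset.card_le_card h1).trans Finset.card_le_two
    rw [List.toFinset_card_of_nodup hc.support_nodup, List.length_tail, Walk.length_support] at h2
    have := hc.three_le_length
    omega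
  · by_cases hab : a = b
    · subst hab
      exact ⟨.nil, by simpa using ha.symm⟩
    · obtain ⟨d, c, hc, h1, h2⟩ := hG a b
      obtain ⟨p, q, hpq, -⟩ := hc.exists_isPathPair h1 h2 hab
      by_cases hp : w ∈ p.support
      · exact ⟨q, fun hq => (hpq.inter w hp hq).elim ha.symm hb.symm⟩
      · exact ⟨p, hp⟩

theorem isBlock_iff_isCyclicallyConnected : G.IsBlock ↔ G.IsCyclicallyConnected :=
  ⟨IsBlock.isCyclicallyConnected, IsCyclicallyConnected.isBlock⟩

theorem IsBlock.induce_compl_preconnected (hG : G.IsBlock) (w : V) :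
    (G.induce ({w} : Set V)ᶜ).Preconnected := by
  rintro ⟨a, ha⟩ ⟨b, hb⟩
  obtain ⟨p, hp⟩ := hG.exists_avoiding w a b ha hb
  exact ⟨p.induce _ fun x hx hxw => hp ((show x = w from hxw) ▸ hx)⟩

theorem IsBlock.isKConnected (hG : G.IsBlock) [Nonempty V] : G.IsKConnected 2 := by
  intro W hW
  have hW' : W.encard ≤ 1 := Order.le_of_lt_add_one (by simpa [one_add_one_eq_two] using hW)
  rcases Set.encard_le_one_iff_eq.1 hW' with rfl | ⟨w, rfl⟩
  · obtain ⟨a⟩ := ‹Nonempty V›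
    have : Nonempty ↥((∅ : Set V)ᶜ) := ⟨⟨a, by simp⟩⟩
    refine ⟨?_⟩
    rintro ⟨a, ha⟩ ⟨b, hb⟩
    obtain ⟨p⟩ := hG.exists_walk a b
    exact ⟨p.induce _ (by simp)⟩
  · obtain ⟨a, ha, -⟩ := hG.exists_third w w
    have : Nonempty ↥(({w} : Set V)ᶜ) := ⟨⟨a, ha⟩⟩
    exact ⟨hG.induce_compl_preconnected w⟩

theorem IsBlock.not_iso_completeGraph_two (hG : G.IsBlock) :
    ¬ Nonempty (G ≃g completeGraph (Fin 2)) := by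
  rintro ⟨f⟩
  obtain ⟨c, h0, h1⟩ := hG.exists_third (f.symm 0) (f.symm 1)
  have : f c = 0 ∨ f c = 1 := by omega
  rcases this with h | h
  · exact h0 (by rw [← h, RelIso.symm_apply_apply])
  · exact h1 (by rw [← h, RelIso.symm_apply_apply])

/-- Only the existence of a third vertex needs care: if all vertices are among `a` and `b`, then
deleting one vertex leaves another, so `a ≠ b`, and connectedness makes them adjacent, so the graph
is `K₂`. -/
theorem IsKConnected.isBlock [Nonempty V] (h2 : G.IsKConnected 2)
    (hK : ¬ Nonempty (G ≃g completeGraph (Fin 2))) : G.IsBlock := by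
  have avoid : ∀ w a b : V, a ≠ w → b ≠ w → ∃ p : G.Walk a b, w ∉ p.support := by
    intro w a b ha hb
    obtain ⟨p⟩ := (h2 {w} (by rw [Set.encard_singleton]; exact_mod_cast one_lt_two)).preconnected
      ⟨a, by simpa using ha⟩ ⟨b, by simpa using hb⟩
    have hq : w ∉ (p.map (Embedding.induce ({w} : Set V)ᶜ).toHom).support := by
      rw [Walk.support_map, List.mem_map]
      rintro ⟨x, -, hx⟩
      exact x.2 hx
    exact ⟨_, hq⟩
  refine ⟨fun a b => ?_, avoid⟩
  by_contra! H
  have hne : ∀ w : V, ∃ x, x ≠ w := fun w => by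
    obtain ⟨x⟩ := (h2 {w} (by rw [Set.encard_singleton]; exact_mod_cast one_lt_two)).nonempty
    exact ⟨x, x.2⟩
  have hab : a ≠ b := by
    rintro rfl
    obtain ⟨x, hx⟩ := hne a
    exact hx (H x hx)
  have hadj : G.Adj a b := by
    obtain ⟨p⟩ := (h2 ∅ (by simp)).preconnected ⟨a, by simp⟩ ⟨b, by simp⟩
    have q := p.map (Embedding.induce _).toHom
    obtain ⟨c, h, -⟩ := Walk.not_nil_iff.1 (Walk.not_nil_of_ne (p := q) hab)
    change G.Adj a c at h
    rwa [H c h.ne'] at h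
  classical
  refine hK ⟨⟨⟨fun x => if x = a then 0 else 1, ![a, b], fun x => ?_, fun i => ?_⟩, ?_⟩⟩
  · by_cases hx : x = a
    · simp [hx]
    · simp [H x hx, hab.symm]
  · fin_cases i <;> simp [hab.symm]
  · intro x y
    by_cases hx : x = a <;> by_cases hy : y = a
    · simp [hx, hy]
    · simp [hx, H y hy, hadj, hab.symm]
    · simp [hy, H x hx, hadj.symm, hab.symm]
    · simp [H x hx, H y hy]

theorem isBlock_iff_isKConnected [Nonempty V] :
    G.IsBlock ↔ ¬ Nonempty (G ≃g completeGraph (Fin 2)) ∧ G.IsKConnected 2 :=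
  ⟨fun h => ⟨h.not_iso_completeGraph_two, h.isKConnected⟩, fun h => h.2.isBlock h.1⟩

/-! ### Adding a vertex, fans, and subdividing an edge. -/

/-- The graph with a new vertex `none` that is adjacent to the vertices in `S`. -/
def addVertex (G : SimpleGraph V) (S : Set V) : SimpleGraph (Option V) where
  Adj
    | some a, some b => G.Adj a b
    | some a, none => a ∈ S
    | none, some b => b ∈ S
    | none, none => False
  symm := ⟨by
    rintro (_ | a) (_ | b) h
    exacts [h, h, h, Adj.symm h]⟩
  loopless := ⟨by
    rintro (_ | a) h
    exacts [h, G.irrefl h]⟩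

theorem exists_walk_addVertex {S : Set V} {a b : V} (p : G.Walk a b) :
    ∃ q : (G.addVertex S).Walk (some a) (some b), ∀ x ∈ q.support, ∃ y ∈ p.support, some y = x := by
  let f : G →g G.addVertex S := ⟨some, fun h => h⟩
  refine ⟨p.map f, fun x hx => ?_⟩
  rw [Walk.support_map, List.mem_map] at hx
  exact hx

theorem exists_walk_of_addVertex {S : Set V} {x y : Option V} (p : (G.addVertex S).Walk x y)
    (hp : none ∉ p.support) {a b : V} (ha : x = some a) (hb : y = some b) :
    ∃ r : G.Walk a b, ∀ z ∈ r.support, some z ∈ p.support := by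
  induction p generalizing a with
  | nil =>
    subst ha
    cases hb
    exact ⟨.nil, by simp⟩
  | @cons x w y h p ih =>
    rw [Walk.support_cons, List.mem_cons, not_or] at hp
    subst ha
    cases w with
    | none => exact absurd p.start_mem_support hp.2
    | some c =>
      obtain ⟨r, hr⟩ := ih hp.2 rfl hb
      have h' : G.Adj a c := h
      refine ⟨.cons h' r, fun z hz => ?_⟩
      rw [Walk.support_cons, List.mem_cons] at hz ⊢
      exact hz.imp (congrArg some) (hr z)

/-- A criterion for a graph with an added vertex to be a block. -/
theorem isBlock_addVertex {S : Set V} {s t : V} (hs : s ∈ S) (ht : t ∈ S) (hst : s ≠ t)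
    (h3 : ∀ a b : V, ∃ c, c ≠ a ∧ c ≠ b) (hG : ∀ a b, G.Reachable a b)
    (hw : ∀ w a b : V, a ≠ w → b ≠ w →
      ∃ p : (G.addVertex S).Walk (some a) (some b), some w ∉ p.support) :
    (G.addVertex S).IsBlock := by
  refine ⟨fun a b => ?_, ?_⟩
  -- The default value `s` is arbitrary, since an old vertex differs from `none` anyway.
  · obtain ⟨c, hca, hcb⟩ := h3 (a.getD s) (b.getD s)
    refine ⟨some c, ?_, ?_⟩ <;> rintro rfl
    exacts [hca rfl, hcb rfl]
  · rintro (_ | w) a b ha hb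
    · obtain ⟨a, rfl⟩ := Option.ne_none_iff_exists'.1 ha
      obtain ⟨b, rfl⟩ := Option.ne_none_iff_exists'.1 hb
      obtain ⟨p⟩ := hG a b
      obtain ⟨q, hq⟩ := exists_walk_addVertex (S := S) p
      exact ⟨q, fun h => by obtain ⟨y, -, hy⟩ := hq _ h; cases hy⟩
    -- Every vertex other than `w` can reach an old vertex other than `w`: the new vertex has two
    -- neighbours `s` and `t`, and `w` is at most one of them.
    · have key : ∀ x : Option V, x ≠ some w → ∃ y, y ≠ w ∧
          ∃ p : (G.addVertex S).Walk x (some y), some w ∉ p.support := by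
        rintro (_ | x) hx
        · have hone : ∀ y ∈ S, y ≠ w →
              ∃ p : (G.addVertex S).Walk none (some y), some w ∉ p.support := by
            intro y hy hyw
            have hadj : (G.addVertex S).Adj none (some y) := hy
            exact ⟨hadj.toWalk, by simp [Adj.toWalk, hyw.symm]⟩
          by_cases hsw : s = w
          · exact ⟨t, fun h => hst (hsw.trans h.symm), hone t ht fun h => hst (hsw.trans h.symm)⟩
          · exact ⟨s, hsw, hone s hs hsw⟩
        · exact ⟨x, fun h => hx (congrArg some h), .nil, by simpa using hx.symm⟩
      obtain ⟨c, hc, p, hp⟩ := key a ha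
      obtain ⟨d, hd, q, hq⟩ := key b hb
      obtain ⟨r, hr⟩ := hw w c d hc hd
      refine ⟨(p.append r).append q.reverse, ?_⟩
      simp only [Walk.mem_support_append_iff, Walk.support_reverse, List.mem_reverse, not_or]
      exact ⟨⟨hp, hr⟩, hq⟩

theorem IsBlock.addVertex (hG : G.IsBlock) {S : Set V} {s t : V} (hs : s ∈ S) (ht : t ∈ S)
    (hst : s ≠ t) : (G.addVertex S).IsBlock := by
  refine isBlock_addVertex hs ht hst hG.exists_third hG.exists_walk fun w a b ha hb => ?_
  obtain ⟨p, hp⟩ := hG.exists_avoiding w a b ha hb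
  obtain ⟨q, hq⟩ := exists_walk_addVertex (S := S) p
  refine ⟨q, fun h => ?_⟩
  obtain ⟨y, hy, hyw⟩ := hq _ h
  cases hyw
  exact hp hy

/-- A block contains two paths from a vertex to a set that meet only in that vertex. -/
theorem IsBlock.exists_fan (hG : G.IsBlock) {S : Set V} {s t z : V} (hs : s ∈ S) (ht : t ∈ S)
    (hst : s ≠ t) (hz : z ∉ S) :
    ∃ (s' t' : V) (P : G.Walk z s') (Q : G.Walk z t'), s' ∈ S ∧ t' ∈ S ∧ s' ≠ t' ∧
      P.IsPath ∧ Q.IsPath ∧ (∀ x ∈ P.support, x ∈ S → x = s') ∧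
      (∀ x ∈ Q.support, x ∈ S → x = t') ∧ ∀ x ∈ P.support, x ∈ Q.support → x = z := by
  -- Menger's theorem for two paths is obtained from a cycle: join a new vertex to all of `S`, take
  -- two disjoint paths from it to `z`, delete the new vertex, and cut each path, read from `z`,
  -- where it first meets `S`.
  obtain ⟨p, q, hpq⟩ := (hG.addVertex hs ht hst).exists_isPathPair
    (u := none) (v := some z) (by simp)
  have key : ∀ p : (G.addVertex S).Walk none (some z), p.IsPath → ∃ (s' : V) (P : G.Walk z s'),
      s' ∈ S ∧ P.IsPath ∧ (∀ x ∈ P.support, some x ∈ p.support) ∧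
      ∀ x ∈ P.support, x ∈ S → x = s' := by
    intro p hp
    cases p with
    | @cons _ w _ h p =>
      rw [Walk.cons_isPath_iff] at hp
      cases w with
      | none => exact absurd p.start_mem_support hp.2
      | some c =>
        obtain ⟨r, hr⟩ := exists_walk_of_addVertex p hp.2 rfl rfl
        obtain ⟨s', P, hP, hs', hPr, hPS⟩ := r.reverse.exists_isPath_first_mem S h
        refine ⟨s', P, hs', hP, fun x hx => ?_, hPS⟩
        have := hPr x hx
        rw [Walk.support_reverse, List.mem_reverse] at this
        rw [Walk.support_cons]
        exact List.mem_cons_of_mem _ (hr x this)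
  obtain ⟨s', P, hs', hP, hPp, hPS⟩ := key p hpq.left
  obtain ⟨t', Q, ht', hQ, hQq, hQS⟩ := key q hpq.right
  have hPQ : ∀ x ∈ P.support, x ∈ Q.support → x = z := fun x hx hy =>
    Option.some_injective _ ((hpq.inter _ (hPp x hx) (hQq x hy)).resolve_left (by simp))
  refine ⟨s', t', P, Q, hs', ht', ?_, hP, hQ, hPS, hQS, hPQ⟩
  rintro rfl
  exact hz (hPQ s' P.end_mem_support Q.end_mem_support ▸ hs')

/-- This is a fan from the middle vertex `y` to the set `{x, z}`; since its two ends are distinct,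
they are `x` and `z` in some order. -/
theorem IsBlock.exists_paths_of_ne (hG : G.IsBlock) {x y z : V} (hxy : x ≠ y) (hyz : y ≠ z)
    (hxz : x ≠ z) : ∃ (P : G.Walk y x) (Q : G.Walk y z), P.IsPath ∧ Q.IsPath ∧
      ∀ w ∈ P.support, w ∈ Q.support → w = y := by
  obtain ⟨s, t, P, Q, hs, ht, hst, hP, hQ, -, -, h⟩ := hG.exists_fan (S := {x, z}) (s := x)
    (t := z) (z := y) (by simp) (by simp) hxz (by simp [hxy.symm, hyz])
  rcases hs with rfl | rfl <;> rcases ht with rfl | rfl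
  · exact absurd rfl hst
  · exact ⟨P, Q, hP, hQ, h⟩
  · exact ⟨Q, P, hQ, hP, fun w h1 h2 => h w h2 h1⟩
  · exact absurd rfl hst

/-- The graph obtained by subdividing the edge `uv`. -/
def subdivide (G : SimpleGraph V) (u v : V) : SimpleGraph (Option V) :=
  (G.deleteEdges {s(u, v)}).addVertex {u, v}

/-- A walk that avoids an old vertex still avoids it when each passage through `uv` is rerouted
through the new vertex. Deleting the new vertex amounts to deleting the edge `uv`, which does not
disconnect a block. -/
theorem IsBlock.subdivide (hG : G.IsBlock) {u v : V} (h : G.Adj u v) :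
    (G.subdivide u v).IsBlock := by
  have hcase : ∀ {a b : V}, G.Adj a b → s(a, b) ≠ s(u, v) →
      (G.deleteEdges {s(u, v)}).Adj a b := fun hab hne => by
    rw [deleteEdges_adj]
    exact ⟨hab, hne⟩
  refine isBlock_addVertex (s := u) (t := v) (by simp) (by simp) h.ne hG.exists_third ?_ ?_
  · intro a b
    obtain ⟨p⟩ := hG.exists_walk a b
    induction p with
    | nil => exact .rfl
    | @cons a c b hac p ih =>
      refine Reachable.trans ?_ ih
      by_cases he : s(a, c) = s(u, v)
      · rcases Sym2.eq_iff.1 he with ⟨rfl, rfl⟩ | ⟨rfl, rfl⟩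
        · exact hG.reachable_deleteEdges h
        · exact (hG.reachable_deleteEdges h).symm
      · exact (hcase hac he).reachable
  · intro w a b ha hb
    obtain ⟨p, hp⟩ := hG.exists_avoiding w a b ha hb
    clear ha hb
    induction p with
    | @nil a => exact ⟨.nil, by simpa using hp⟩
    | @cons a c b hac p ih =>
      rw [Walk.support_cons, List.mem_cons, not_or] at hp
      obtain ⟨q, hq⟩ := ih hp.2
      have hwa : some w ≠ some a := fun h => hp.1 (Option.some_injective _ h)
      by_cases he : s(a, c) = s(u, v)
      · have h1 : ((G.deleteEdges {s(u, v)}).addVertex {u, v}).Adj (some a) none := by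
          change a ∈ ({u, v} : Set V)
          have : a ∈ s(u, v) := he ▸ Sym2.mem_mk_left a c
          simpa using this
        have h2 : ((G.deleteEdges {s(u, v)}).addVertex {u, v}).Adj none (some c) := by
          change c ∈ ({u, v} : Set V)
          have : c ∈ s(u, v) := he ▸ Sym2.mem_mk_right a c
          simpa using this
        refine ⟨.cons h1 (.cons h2 q), ?_⟩
        simp only [Walk.support_cons, List.mem_cons, not_or]
        exact ⟨hwa, by simp, hq⟩
      · have h1 : ((G.deleteEdges {s(u, v)}).addVertex {u, v}).Adj (some a) (some c) := hcase hac he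
        refine ⟨.cons h1 q, ?_⟩
        simp only [Walk.support_cons, List.mem_cons, not_or]
        exact ⟨hwa, hq⟩

end SimpleGraph

/-! ### Arcs: concatenation, division, circles and θ-curves. -/

section Arcs

variable {X : Type*} [TopologicalSpace X]

/-- `A` is an arc with ends `a` and `b`. -/
def IsArc (A : Set X) (a b : X) : Prop :=
  ∃ γ : Path a b, Function.Injective γ ∧ Set.range γ = A

namespace IsArc

variable {A B C : Set X} {a b c x : X}

theorem symm (h : IsArc A a b) : IsArc A b a := by
  obtain ⟨γ, hγ, rfl⟩ := h
  exact ⟨γ.symm, hγ.comp unitInterval.symm_bijective.injective, γ.symm_range⟩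

theorem left_mem (h : IsArc A a b) : a ∈ A := by
  obtain ⟨γ, -, rfl⟩ := h
  exact ⟨0, γ.source⟩

theorem right_mem (h : IsArc A a b) : b ∈ A := h.symm.left_mem

end IsArc

/-- Two parameters with the same value under a concatenation of two injective paths. -/
theorem Path.exists_of_trans_eq {a b c : X} {γ : Path a b} {δ : Path b c}
    (hγ : Function.Injective γ) (hδ : Function.Injective δ) {s t : unitInterval} (hst : s < t)
    (h : γ.trans δ s = γ.trans δ t) :
    ∃ q r : unitInterval, (q : ℝ) = 2 * s ∧ (r : ℝ) = 2 * t - 1 ∧ γ q = δ r ∧ r ≠ 0 ∧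
      γ.trans δ s = γ q := by
  have hst' : (s : ℝ) < t := hst
  rw [Path.trans_apply, Path.trans_apply] at h
  rw [Path.trans_apply]
  split_ifs at h with h1 h2 h3
  · have := congrArg Subtype.val (hγ h)
    simp only at this
    linarith
  · rw [dif_pos h1]
    -- The parameter `1 / 2` of the concatenation belongs to the first path, so `2 * t - 1` is
    -- positive here. This excludes the start of `δ`, where the two paths always meet.
    refine ⟨_, _, rfl, rfl, h, ?_, rfl⟩
    intro h0
    have := congrArg Subtype.val h0
    simp only [Set.Icc.coe_zero] at this
    linarith
  · linarith
  · have := congrArg Subtype.val (hδ h)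
    simp only at this
    linarith

namespace IsArc

variable {A B C : Set X} {a b c x : X}

/-- The parameter of the junction `b` is recorded because the order of three points on an arc is
later read off from it. -/
theorem exists_path_trans (hA : IsArc A a b) (hB : IsArc B b c) (h : A ∩ B ⊆ {b}) :
    ∃ γ : Path a c, Function.Injective γ ∧ Set.range γ = A ∪ B ∧
      γ ⟨1 / 2, by norm_num, by norm_num⟩ = b := by
  obtain ⟨γ, hγ, rfl⟩ := hA
  obtain ⟨δ, hδ, rfl⟩ := hB
  refine ⟨γ.trans δ, ?_, Path.trans_range _ _, ?_⟩
  · refine Function.Injective.of_lt_imp_ne fun s t hst heq => ?_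
    obtain ⟨q, r, -, -, hqr, hr, -⟩ := Path.exists_of_trans_eq hγ hδ hst heq
    have hb : δ r = b := h ⟨⟨q, hqr⟩, ⟨r, rfl⟩⟩
    exact hr (hδ (hb.trans δ.source.symm))
  · rw [Path.trans_apply]
    simp

theorem trans (hA : IsArc A a b) (hB : IsArc B b c) (h : A ∩ B ⊆ {b}) : IsArc (A ∪ B) a c := by
  obtain ⟨γ, hγ, hr, -⟩ := hA.exists_path_trans hB h
  exact ⟨γ, hγ, hr⟩

/-- Two arcs with the same ends and no other common points form a circle. -/
theorem isCircleIn_union {X : Type u} [TopologicalSpace X] [T2Space X] {A B : Set X} {a b : X}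
    (hA : IsArc A a b) (hB : IsArc B a b) (h : A ∩ B ⊆ {a, b}) : IsCircleIn (A ∪ B) := by
  obtain ⟨γ, hγ, rfl⟩ := hA
  obtain ⟨δ, hδ, rfl⟩ := hB.symm
  -- The concatenation is a loop at `a` whose only repeated value is at its two ends, so it descends
  -- to an injective map on the quotient circle.
  have hends : ∀ s t : unitInterval, s < t → γ.trans δ s = γ.trans δ t → s = 0 ∧ t = 1 := by
    intro s t hst heq
    obtain ⟨q, r, hq, hr, hqr, hr0, -⟩ := Path.exists_of_trans_eq hγ hδ hst heq
    rcases h ⟨⟨q, hqr⟩, ⟨r, rfl⟩⟩ with h1 | h1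
    · have hq' : q = 0 := hγ ((hqr.trans h1).trans γ.source.symm)
      have hr' : r = 1 := hδ (h1.trans δ.target.symm)
      rw [hq', Set.Icc.coe_zero] at hq
      rw [hr', Set.Icc.coe_one] at hr
      exact ⟨Subtype.ext (by rw [Set.Icc.coe_zero]; linarith),
        Subtype.ext (by rw [Set.Icc.coe_one]; linarith)⟩
    · exact absurd (hδ (h1.trans δ.source.symm)) hr0
  let f : ℝ → X := (γ.trans δ).extend
  have hf : ∀ t (ht : t ∈ unitInterval), f t = γ.trans δ ⟨t, ht⟩ := fun t ht =>
    Path.extend_apply _ ht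
  have h01 : f 0 = f 1 := by simp [f]
  let g : AddCircle (1 : ℝ) → X := AddCircle.liftIco 1 0 f
  have hg : Continuous g :=
    AddCircle.liftIco_zero_continuous h01 (γ.trans δ).continuous_extend.continuousOn
  have hrep : ∀ z : AddCircle (1 : ℝ), ∃ t ∈ Set.Ico (0 : ℝ) 1, (t : AddCircle (1 : ℝ)) = z := by
    intro z
    have : z ∈ ((↑) : ℝ → AddCircle (1 : ℝ)) '' Set.Ico 0 (0 + 1) := by
      rw [AddCircle.coe_image_Ico_eq]
      trivial
    simpa using this
  have hgf : ∀ t ∈ Set.Ico (0 : ℝ) 1, g t = f t := fun t ht => AddCircle.liftIco_zero_coe_apply ht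
  have hinj : Function.Injective g := by
    have key : ∀ s ∈ Set.Ico (0 : ℝ) 1, ∀ t ∈ Set.Ico (0 : ℝ) 1, s < t → f s ≠ f t := by
      intro s hs t ht hst heq
      rw [hf s ⟨hs.1, hs.2.le⟩, hf t ⟨ht.1, ht.2.le⟩] at heq
      have := congrArg Subtype.val (hends _ _ (Subtype.mk_lt_mk.2 hst) heq).2
      exact ht.2.ne this
    intro y z hyz
    obtain ⟨s, hs, rfl⟩ := hrep y
    obtain ⟨t, ht, rfl⟩ := hrep z
    rw [hgf s hs, hgf t ht] at hyz
    rcases lt_trichotomy s t with hst | rfl | hst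
    · exact absurd hyz (key s hs t ht hst)
    · rfl
    · exact absurd hyz.symm (key t ht s hs hst)
  have hrange : Set.range g = Set.range γ ∪ Set.range δ := by
    rw [← Path.trans_range]
    ext x
    constructor
    · rintro ⟨z, rfl⟩
      obtain ⟨t, ht, rfl⟩ := hrep z
      exact ⟨⟨t, ht.1, ht.2.le⟩, by rw [hgf t ht, hf t ⟨ht.1, ht.2.le⟩]⟩
    · rintro ⟨t, rfl⟩
      by_cases ht : (t : ℝ) < 1
      · exact ⟨((t : ℝ) : AddCircle (1 : ℝ)), by rw [hgf t ⟨t.2.1, ht⟩, hf t t.2]⟩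
      · have : t = 1 := Subtype.ext (le_antisymm t.2.2 (not_lt.1 ht))
        subst this
        refine ⟨((0 : ℝ) : AddCircle (1 : ℝ)), ?_⟩
        rw [hgf 0 ⟨le_rfl, one_pos⟩, h01]
        simp [f]
  exact ⟨(((hg.isClosedEmbedding hinj).isEmbedding.toHomeomorph).trans
    (Homeomorph.setCongr hrange)).symm.trans (AddCircle.homeomorphCircle one_ne_zero)⟩

theorem isThetaCurveIn_union {X : Type u} [TopologicalSpace X] [T2Space X] {A B C : Set X}
    {a b : X} (hab : a ≠ b) (hA : IsArc A a b) (hB : IsArc B a b) (hC : IsArc C a b)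
    (hAB : A ∩ B ⊆ {a, b}) (hAC : A ∩ C ⊆ {a, b}) (hBC : B ∩ C ⊆ {a, b}) :
    IsThetaCurveIn (A ∪ B ∪ C) := by
  have hsub : ∀ {A B : Set X}, IsArc A a b → IsArc B a b → A ∩ B ⊆ {a, b} → A ∩ B = {a, b} := by
    intro A B hA hB h
    refine h.antisymm ?_
    rintro x (rfl | rfl)
    exacts [⟨hA.left_mem, hB.left_mem⟩, ⟨hA.right_mem, hB.right_mem⟩]
  have h1 := hsub hA hB hAB
  have h2 := hsub hA hC hAC
  have h3 := hsub hB hC hBC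
  obtain ⟨α, hα, rfl⟩ := hA
  obtain ⟨β, hβ, rfl⟩ := hB
  obtain ⟨γ, hγ, rfl⟩ := hC
  refine ⟨a, b, ![α, β, γ], hab, fun i => ?_, fun i j hij => ?_, ?_⟩
  · fin_cases i
    · exact ⟨(α.continuous.isClosedEmbedding hα).isEmbedding, α.source, α.target⟩
    · exact ⟨(β.continuous.isClosedEmbedding hβ).isEmbedding, β.source, β.target⟩
    · exact ⟨(γ.continuous.isClosedEmbedding hγ).isEmbedding, γ.source, γ.target⟩
  · fin_cases i <;> fin_cases j
    · exact absurd rfl hij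
    · exact h1
    · exact h2
    · exact (Set.inter_comm _ _).trans h1
    · exact absurd rfl hij
    · exact h3
    · exact (Set.inter_comm _ _).trans h2
    · exact (Set.inter_comm _ _).trans h3
    · exact absurd rfl hij
  · ext x
    simp [Fin.exists_fin_succ, or_assoc]

theorem _root_.Path.subpath_injective {γ : Path a b} (hγ : Function.Injective γ)
    {s t : unitInterval} (hst : s ≠ t) : Function.Injective (γ.subpath s t) := by
  intro q r hqr
  have h := congrArg Subtype.val (hγ hqr)
  have h' : (1 - (q : ℝ)) * s + q * t = (1 - (r : ℝ)) * s + r * t := h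
  have h0 : ((q : ℝ) - r) * ((t : ℝ) - s) = 0 := by linear_combination h'
  rcases mul_eq_zero.1 h0 with h1 | h1
  · exact Subtype.ext (by linarith)
  · exact absurd (Subtype.ext (by linarith)) hst

/-- An inner point divides an arc into two arcs. -/
theorem exists_split (hA : IsArc A a b) (hx : x ∈ A) (hxa : x ≠ a) (hxb : x ≠ b) :
    ∃ B C, IsArc B x a ∧ IsArc C x b ∧ B ∪ C = A ∧ B ∩ C ⊆ {x} := by
  obtain ⟨γ, hγ, rfl⟩ := hA
  obtain ⟨t, rfl⟩ := hx
  have ht0 : t ≠ 0 := by rintro rfl; exact hxa γ.source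
  have ht1 : t ≠ 1 := by rintro rfl; exact hxb γ.target
  refine ⟨_, _, ⟨(γ.subpath t 0).cast rfl γ.source.symm, Path.subpath_injective hγ ht0, rfl⟩,
    ⟨(γ.subpath t 1).cast rfl γ.target.symm, Path.subpath_injective hγ ht1, rfl⟩, ?_, ?_⟩
  · rw [Path.cast_coe, Path.cast_coe, Path.range_subpath_of_ge _ _ _ t.2.1,
      Path.range_subpath_of_le _ _ _ t.2.2, ← Set.image_union,
      Set.Icc_union_Icc_eq_Icc unitInterval.nonneg' unitInterval.le_one']
    rw [← Set.image_univ]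
    congr 1
    exact Set.eq_univ_of_forall fun s => ⟨s.2.1, s.2.2⟩
  · rw [Path.cast_coe, Path.cast_coe, Path.range_subpath_of_ge _ _ _ t.2.1,
      Path.range_subpath_of_le _ _ _ t.2.2]
    rintro _ ⟨⟨q, hq, rfl⟩, ⟨r, hr, hqr⟩⟩
    obtain rfl := hγ hqr
    exact congrArg γ (le_antisymm hq.2 hr.1)

end IsArc

end Arcs

/-! ### Drawings of graphs by arcs. -/

namespace SimpleGraph

/-- A drawing of a graph on a space that it covers: distinct vertices are mapped to distinct points
and edges to arcs between their ends, where different edges meet only in common ends. -/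
structure IsDrawing {W X : Type*} [TopologicalSpace X] (H : SimpleGraph W) (pt : W → X)
    (E : Sym2 W → Set X) : Prop where
  injective : Function.Injective pt
  isArc : ∀ {a b : W}, H.Adj a b → IsArc (E s(a, b)) (pt a) (pt b)
  inter : ∀ {e f : Sym2 W}, e ∈ H.edgeSet → f ∈ H.edgeSet → e ≠ f →
    ∀ x ∈ E e, x ∈ E f → ∃ c ∈ e, c ∈ f ∧ pt c = x
  cover : ∀ x, (∃ c, pt c = x) ∨ ∃ e ∈ H.edgeSet, x ∈ E e

/-- The union of the arcs that represent the edges of a walk. -/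
def Walk.drawn {W X : Type*} {H : SimpleGraph W} (E : Sym2 W → Set X) {a b : W}
    (p : H.Walk a b) : Set X :=
  {x | ∃ e ∈ p.edges, x ∈ E e}

theorem Walk.drawn_cons {W X : Type*} {H : SimpleGraph W} {E : Sym2 W → Set X} {a b c : W}
    (h : H.Adj a b) (p : H.Walk b c) : (Walk.cons h p).drawn E = E s(a, b) ∪ p.drawn E := by
  ext x
  simp [Walk.drawn]

namespace IsDrawing

section

variable {W X : Type*} [TopologicalSpace X] {H : SimpleGraph W} {pt : W → X}
  {E : Sym2 W → Set X}

theorem mem_of_mem_edge (D : H.IsDrawing pt E) {e : Sym2 W} (he : e ∈ H.edgeSet) {c : W}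
    (hc : c ∈ e) : pt c ∈ E e := by
  induction e with
  | _ a b =>
    rcases Sym2.mem_iff.1 hc with rfl | rfl
    · exact (D.isArc he).left_mem
    · exact (D.isArc he).right_mem

theorem mem_drawn (D : H.IsDrawing pt E) {a b c : W} {p : H.Walk a b} (hab : a ≠ b)
    (hc : c ∈ p.support) : pt c ∈ p.drawn E := by
  obtain ⟨e, he, hce⟩ :=
    (Walk.mem_support_iff_exists_mem_edges_of_not_nil (Walk.not_nil_of_ne hab)).1 hc
  exact ⟨e, he, D.mem_of_mem_edge (p.edges_subset_edgeSet he) hce⟩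

/-- Walks without common edges are drawn so that they meet only in common vertices. -/
theorem exists_of_mem_drawn (D : H.IsDrawing pt E) {a b c d : W} {p : H.Walk a b} {q : H.Walk c d}
    (hpq : ∀ e ∈ p.edges, e ∉ q.edges) {x : X} (hp : x ∈ p.drawn E) (hq : x ∈ q.drawn E) :
    ∃ v ∈ p.support, v ∈ q.support ∧ pt v = x := by
  obtain ⟨e, he, hxe⟩ := hp
  obtain ⟨f, hf, hxf⟩ := hq
  obtain ⟨v, hve, hvf, hv⟩ := D.inter (p.edges_subset_edgeSet he) (q.edges_subset_edgeSet hf)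
    (fun h => hpq e he (h ▸ hf)) x hxe hxf
  exact ⟨v, Walk.mem_support_of_mem_edge he hve, Walk.mem_support_of_mem_edge hf hvf, hv⟩

/-- An edge and the rest of the path can meet only in a vertex common to both, and the first vertex
of a path does not recur. The ends must differ because a trivial walk is drawn as the empty set. -/
theorem isArc_drawn (D : H.IsDrawing pt E) {a b : W} (p : H.Walk a b) (hp : p.IsPath)
    (hab : a ≠ b) : IsArc (p.drawn E) (pt a) (pt b) := by
  induction p with
  | nil => exact absurd rfl hab
  | @cons a b c h p ih =>
    rw [Walk.cons_isPath_iff] at hp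
    rw [Walk.drawn_cons]
    by_cases hbc : b = c
    · subst hbc
      have hnil : p = .nil := (Walk.isPath_iff_nil.1 hp.1).eq_nil
      subst hnil
      simpa [Walk.drawn] using D.isArc h
    · refine (D.isArc h).trans (ih hp.1 hbc) ?_
      rintro x ⟨hx, hx'⟩
      have hx1 : x ∈ (Walk.cons h .nil : H.Walk a b).drawn E := ⟨s(a, b), by simp, hx⟩
      obtain ⟨v, hv, hv', rfl⟩ := D.exists_of_mem_drawn (fun e he hf => by
        simp only [Walk.edges_cons, Walk.edges_nil, List.mem_singleton] at he
        subst he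
        exact hp.2 (p.fst_mem_support_of_mem_edges hf)) hx1 hx'
      simp only [Walk.support_cons, Walk.support_nil, List.mem_cons, List.not_mem_nil,
        or_false] at hv
      rcases hv with rfl | rfl
      · exact absurd hv' hp.2
      · rfl

theorem drawn_inter_subset (D : H.IsDrawing pt E) {a b : W} {p q : H.Walk a b}
    (h : IsPathPair p q) : p.drawn E ∩ q.drawn E ⊆ {pt a, pt b} := by
  rintro x ⟨hx, hx'⟩
  obtain ⟨v, hv, hv', rfl⟩ := D.exists_of_mem_drawn h.edges hx hx'
  rcases h.inter v hv hv' with rfl | rfl <;> simp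

theorem drawn_inter_subset_singleton (D : H.IsDrawing pt E) {x y z : W} {P : H.Walk y x}
    {Q : H.Walk y z} (h : ∀ w ∈ P.support, w ∈ Q.support → w = y) : P.drawn E ∩ Q.drawn E ⊆ {pt y} := by
  rintro w ⟨hw, hw'⟩
  have hPQ : ∀ e ∈ P.edges, e ∉ Q.edges := fun e he hf =>
    Walk.not_mem_edges_of_forall_eq (S := {w | w ∈ Q.support}) h he
      fun u hu => Walk.mem_support_of_mem_edge hf hu
  obtain ⟨v, hv, hv', rfl⟩ := D.exists_of_mem_drawn hPQ hw hw'
  rw [h v hv hv']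
  rfl

/-- Three distinct vertices of a drawn block lie on an arc in the given order. -/
theorem exists_path_through (D : H.IsDrawing pt E) (hH : H.IsBlock) {x y z : W} (hxy : x ≠ y)
    (hyz : y ≠ z) (hxz : x ≠ z) : ∃ γ : _root_.Path (pt x) (pt z), Function.Injective γ ∧
      γ ⟨1 / 2, by norm_num, by norm_num⟩ = pt y := by
  obtain ⟨P, Q, hP, hQ, h⟩ := hH.exists_paths_of_ne hxy hyz hxz
  obtain ⟨γ, hγ, -, hy⟩ := (D.isArc_drawn P hP hxy.symm).symm.exists_path_trans
    (D.isArc_drawn Q hQ hyz) (D.drawn_inter_subset_singleton h)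
  exact ⟨γ, hγ, hy⟩

end

variable {W X : Type u} [TopologicalSpace X] [T2Space X] {H : SimpleGraph W} {pt : W → X}
  {E : Sym2 W → Set X}

theorem isCircleIn_drawn (D : H.IsDrawing pt E) {a b : W} {p q : H.Walk a b}
    (h : IsPathPair p q) (hab : a ≠ b) : IsCircleIn (p.drawn E ∪ q.drawn E) :=
  (D.isArc_drawn p h.left hab).isCircleIn_union (D.isArc_drawn q h.right hab)
    (D.drawn_inter_subset h)

theorem exists_isCircleIn (D : H.IsDrawing pt E) (hH : H.IsBlock) {x y : W} (hxy : x ≠ y) :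
    ∃ C : Set X, IsCircleIn C ∧ pt x ∈ C ∧ pt y ∈ C := by
  obtain ⟨p, q, h⟩ := hH.exists_isPathPair hxy
  exact ⟨_, D.isCircleIn_drawn h hxy, .inl (D.mem_drawn hxy p.start_mem_support),
    .inl (D.mem_drawn hxy p.end_mem_support)⟩

/-- Three vertices of a drawn block, the first two distinct, lie on a circle or a θ-curve. -/
theorem exists_circle_or_theta (D : H.IsDrawing pt E) (hH : H.IsBlock) {x y : W} (hxy : x ≠ y)
    (z : W) : ∃ T : Set X, (IsCircleIn T ∨ IsThetaCurveIn T) ∧ pt x ∈ T ∧ pt y ∈ T ∧ pt z ∈ T := by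
  obtain ⟨a, c, hc, hx, hy⟩ := hH.onCommonCycle_of_ne hxy
  by_cases hz : z ∈ c.support
  · by_cases hxz : x = z
    · subst hxz
      obtain ⟨C, hC, h1, h2⟩ := D.exists_isCircleIn hH hxy
      exact ⟨C, .inl hC, h1, h2, h1⟩
    · obtain ⟨p, q, hpq, hcpq⟩ := hc.exists_isPathPair hx hy hxy
      have hmem : ∀ v ∈ c.support, pt v ∈ p.drawn E ∪ q.drawn E := fun v hv =>
        ((hcpq v).1 hv).imp (D.mem_drawn hxy) (D.mem_drawn hxy)
      exact ⟨_, .inl (D.isCircleIn_drawn hpq hxy), hmem x hx, hmem y hy, hmem z hz⟩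
  -- A fan from `z` to the cycle is drawn as an arc between two points `s` and `t` of the cycle;
  -- with the two paths of the cycle between `s` and `t` it forms a θ-curve.
  · obtain ⟨s, t, P, Q, hs, ht, hst, hP, hQ, hPS, hQS, hPQ⟩ :=
      hH.exists_fan (S := {v | v ∈ c.support}) hx hy hxy hz
    obtain ⟨p, q, hpq, hcpq⟩ := hc.exists_isPathPair hs ht hst
    have hmem : ∀ v ∈ c.support, pt v ∈ p.drawn E ∪ q.drawn E := fun v hv =>
      ((hcpq v).1 hv).imp (D.mem_drawn hst) (D.mem_drawn hst)
    have hzs : z ≠ s := by rintro rfl; exact hz hs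
    have hzt : z ≠ t := by rintro rfl; exact hz ht
    have hear := (D.isArc_drawn P hP hzs).symm.trans (D.isArc_drawn Q hQ hzt)
      (D.drawn_inter_subset_singleton hPQ)
    have hinter : ∀ r : H.Walk s t, (∀ v ∈ r.support, v ∈ c.support) →
        r.drawn E ∩ (P.drawn E ∪ Q.drawn E) ⊆ {pt s, pt t} := by
      rintro r hr w ⟨hw, hw' | hw'⟩
      · obtain ⟨v, hv, hv', rfl⟩ := D.exists_of_mem_drawn (fun e he hf =>
          Walk.not_mem_edges_of_forall_eq hPS hf
            fun u hu => hr u (Walk.mem_support_of_mem_edge he hu)) hw hw'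
        rw [hPS v hv' (hr v hv)]; simp
      · obtain ⟨v, hv, hv', rfl⟩ := D.exists_of_mem_drawn (fun e he hf =>
          Walk.not_mem_edges_of_forall_eq hQS hf
            fun u hu => hr u (Walk.mem_support_of_mem_edge he hu)) hw hw'
        rw [hQS v hv' (hr v hv)]; simp
    refine ⟨_, .inr (IsArc.isThetaCurveIn_union (D.injective.ne hst)
      (D.isArc_drawn p hpq.left hst) (D.isArc_drawn q hpq.right hst) hear
      (D.drawn_inter_subset hpq) (hinter p fun v hv => (hcpq v).2 (.inl hv))
      (hinter q fun v hv => (hcpq v).2 (.inr hv))), .inl (hmem x hx), .inl (hmem y hy),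
      .inr (.inl (D.mem_drawn hzs P.start_mem_support))⟩

end IsDrawing

end SimpleGraph

instance : Infinite unitInterval := Set.infinite_coe_iff.2 (Set.Icc_infinite one_pos)

namespace SimpleGraph

/-! ### Subdividing an edge of a drawing. -/

section Subdivision

variable {V : Type*} {G : SimpleGraph V}

theorem mem_edgeSet_subdivide {u v : V} {e : Sym2 (Option V)} :
    e ∈ (G.subdivide u v).edgeSet ↔ e = s(none, some u) ∨ e = s(none, some v) ∨
      ∃ f ∈ G.edgeSet, f ≠ s(u, v) ∧ f.map some = e := by
  constructor
  · intro he
    induction e with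
    | _ x y =>
      rcases x with _ | a <;> rcases y with _ | b
      · exact ((G.subdivide u v).irrefl ((mem_edgeSet _).1 he)).elim
      · exact (show b = u ∨ b = v from he).elim (fun h => .inl (by rw [h]))
          fun h => .inr (.inl (by rw [h]))
      · exact (show a = u ∨ a = v from he).elim (fun h => .inl (by rw [h, Sym2.eq_swap]))
          fun h => .inr (.inl (by rw [h, Sym2.eq_swap]))
      · have hab : (G.deleteEdges {s(u, v)}).Adj a b := he
        rw [deleteEdges_adj] at hab
        exact .inr (.inr ⟨s(a, b), hab.1, hab.2, rfl⟩)
  · rintro (rfl | rfl | ⟨f, hf, hfe, rfl⟩)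
    · exact (show u = u ∨ u = v from .inl rfl)
    · exact (show v = u ∨ v = v from .inr rfl)
    · induction f with
      | _ a b =>
        exact (show (G.deleteEdges {s(u, v)}).Adj a b from (deleteEdges_adj).2 ⟨hf, hfe⟩)

open Classical in
/-- The arcs of a drawing in which the edge `uv` is replaced by an arc `A` that ends in `u` and an
arc `B` that ends in `v`. -/
noncomputable def subdivideArcs {X : Type*} (E : Sym2 V → Set X) (u v : V) (A B : Set X)
    (e : Sym2 (Option V)) : Set X :=
  if e = s(none, some u) then A else if e = s(none, some v) then B
  -- The default value `u` is immaterial, since the remaining edges of the subdivided graph do not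
  -- contain `none`.
  else E (e.map fun x => x.getD u)

variable {X : Type*} [TopologicalSpace X] {pt : V → X} {E : Sym2 V → Set X}

theorem IsDrawing.subdivide (D : G.IsDrawing pt E) {u v : V} (h : G.Adj u v) {x : X}
    {A B : Set X} (hA : IsArc A x (pt u)) (hB : IsArc B x (pt v)) (hAB : A ∪ B = E s(u, v))
    (hinter : A ∩ B ⊆ {x}) (hx : ∀ c, pt c ≠ x) :
    (G.subdivide u v).IsDrawing (fun o => o.elim x pt) (subdivideArcs E u v A B) := by
  have hne : s((none : Option V), some u) ≠ s(none, some v) := by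
    intro heq
    rcases Sym2.eq_iff.1 heq with ⟨-, h'⟩ | ⟨h', -⟩
    · exact h.ne (Option.some_injective _ h')
    · cases h'
  have hEA : subdivideArcs E u v A B s(none, some u) = A := if_pos rfl
  have hEB : subdivideArcs E u v A B s(none, some v) = B :=
    (if_neg hne.symm).trans (if_pos rfl)
  have hmem : ∀ f : Sym2 V, none ∉ f.map some := by simp
  have hEf : ∀ f : Sym2 V, subdivideArcs E u v A B (f.map some) = E f := by
    intro f
    have h1 : ∀ w, f.map some ≠ s(none, some w) := fun w hw =>
      hmem f (hw ▸ Sym2.mem_mk_left _ _)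
    rw [subdivideArcs, if_neg (h1 u), if_neg (h1 v), Sym2.map_map]
    exact congrArg E (congrFun Sym2.map_id f)
  -- A half of the divided arc meets another edge only in its old end: the other end of `uv` lies on
  -- the other half, and the halves share only `x`, which is not an old vertex. The claim is
  -- symmetric in the two halves so that it serves for both.
  have hend : ∀ {f}, f ∈ G.edgeSet → f ≠ s(u, v) → ∀ {C C' : Set X} {w w' : V},
      s(w, w') = s(u, v) → IsArc C x (pt w) → IsArc C' x (pt w') → C ∪ C' = E s(u, v) →
      C ∩ C' ⊆ {x} → ∀ y ∈ C, y ∈ E f → w ∈ f ∧ pt w = y := by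
    intro f hf hfe C C' w w' hww hC hC' hCC hCi y hy hyf
    obtain ⟨c, hc, hcf, rfl⟩ := D.inter hf h hfe y hyf (hCC ▸ .inl hy)
    have hc' : c ∈ s(w, w') := hww ▸ hcf
    rcases Sym2.mem_iff.1 hc' with rfl | rfl
    · exact ⟨hc, rfl⟩
    · exact absurd (hCi ⟨hy, hC'.right_mem⟩) (hx c)
  have hendA : ∀ {f}, f ∈ G.edgeSet → f ≠ s(u, v) → ∀ y ∈ A, y ∈ E f → u ∈ f ∧ pt u = y :=
    fun hf hfe => hend hf hfe rfl hA hB hAB hinter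
  have hendB : ∀ {f}, f ∈ G.edgeSet → f ≠ s(u, v) → ∀ y ∈ B, y ∈ E f → v ∈ f ∧ pt v = y :=
    fun hf hfe => hend hf hfe Sym2.eq_swap hB hA (Set.union_comm A B ▸ hAB)
      (Set.inter_comm A B ▸ hinter)
  refine ⟨?_, ?_, ?_, ?_⟩
  · rintro (_ | a) (_ | b) hab
    · rfl
    · exact absurd hab.symm (hx b)
    · exact absurd hab (hx a)
    · exact congrArg some (D.injective hab)
  · rintro (_ | a) (_ | b) hab
    · exact absurd rfl hab.ne
    · rcases (show b = u ∨ b = v from hab) with rfl | rfl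
      · rw [hEA]; exact hA
      · rw [hEB]; exact hB
    · rw [Sym2.eq_swap]
      rcases (show a = u ∨ a = v from hab) with rfl | rfl
      · rw [hEA]; exact hA.symm
      · rw [hEB]; exact hB.symm
    · have hab' : (G.deleteEdges {s(u, v)}).Adj a b := hab
      rw [deleteEdges_adj] at hab'
      rw [show s(some a, some b) = Sym2.map some s(a, b) from rfl, hEf]
      exact D.isArc hab'.1
  · intro e f he hf hef y hy hy'
    rcases mem_edgeSet_subdivide.1 he with rfl | rfl | ⟨e, he₀, hee, rfl⟩ <;>
      rcases mem_edgeSet_subdivide.1 hf with rfl | rfl | ⟨f, hf₀, hff, rfl⟩ <;>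
      simp only [hEA, hEB, hEf] at hy hy'
    · exact absurd rfl hef
    · exact ⟨none, by simp, by simp, (hinter ⟨hy, hy'⟩ : y = x).symm⟩
    · obtain ⟨h1, h2⟩ := hendA hf₀ hff y hy hy'
      exact ⟨some u, by simp, by simpa using h1, h2⟩
    · exact ⟨none, by simp, by simp, (hinter ⟨hy', hy⟩ : y = x).symm⟩
    · exact absurd rfl hef
    · obtain ⟨h1, h2⟩ := hendB hf₀ hff y hy hy'
      exact ⟨some v, by simp, by simpa using h1, h2⟩
    · obtain ⟨h1, h2⟩ := hendA he₀ hee y hy' hy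
      exact ⟨some u, by simpa using h1, by simp, h2⟩
    · obtain ⟨h1, h2⟩ := hendB he₀ hee y hy' hy
      exact ⟨some v, by simpa using h1, by simp, h2⟩
    · obtain ⟨c, h1, h2, h3⟩ := D.inter he₀ hf₀ (fun h => hef (congrArg _ h)) y hy hy'
      exact ⟨some c, by simpa using h1, by simpa using h2, h3⟩
  · intro y
    rcases D.cover y with ⟨c, hc⟩ | ⟨e, he, hy⟩
    · exact .inl ⟨some c, hc⟩
    · right
      by_cases hee : e = s(u, v)
      · rw [hee, ← hAB] at hy
        rcases hy with hy | hy
        · exact ⟨_, mem_edgeSet_subdivide.2 (.inl rfl), by rwa [hEA]⟩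
        · exact ⟨_, mem_edgeSet_subdivide.2 (.inr (.inl rfl)), by rwa [hEB]⟩
      · exact ⟨_, mem_edgeSet_subdivide.2 (.inr (.inr ⟨e, he, hee, rfl⟩)), by rwa [hEf]⟩

end Subdivision

/-! ### Circles, θ-curves and ordered arcs through arbitrary points. -/

/-- A drawing of some block on the space `X`. -/
structure BlockDrawing (X : Type u) [TopologicalSpace X] where
  {W : Type u}
  {H : SimpleGraph W}
  {pt : W → X}
  {E : Sym2 W → Set X}
  isBlock : H.IsBlock
  isDrawing : H.IsDrawing pt E

namespace BlockDrawing

variable {X : Type u} [TopologicalSpace X]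

/-- A point that is not a vertex is an inner point of an edge, where the edge can be subdivided
without changing the space. -/
theorem exists_refinement (D : BlockDrawing X) (x : X) :
    ∃ D' : BlockDrawing X, Set.range D.pt ⊆ Set.range D'.pt ∧ x ∈ Set.range D'.pt := by
  by_cases hx : x ∈ Set.range D.pt
  · exact ⟨D, subset_rfl, hx⟩
  · have hx' : ∀ c, D.pt c ≠ x := fun c hc => hx ⟨c, hc⟩
    obtain ⟨e, he, hxe⟩ := (D.isDrawing.cover x).resolve_left hx
    induction e with
    | _ u v =>
      obtain ⟨A, B, hA, hB, hAB, hi⟩ :=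
        (D.isDrawing.isArc he).exists_split hxe (hx' u).symm (hx' v).symm
      refine ⟨⟨D.isBlock.subdivide he, D.isDrawing.subdivide he hA hB hAB hi hx'⟩, ?_,
        ⟨none, rfl⟩⟩
      rintro _ ⟨c, rfl⟩
      exact ⟨some c, rfl⟩

/-- By subdividing edges, finitely many points can be made vertices of a drawing. -/
theorem exists_subset_range (D : BlockDrawing X) (S : Finset X) :
    ∃ D' : BlockDrawing X, (S : Set X) ⊆ Set.range D'.pt := by
  classical
  induction S using Finset.induction with
  | empty => exact ⟨D, by simp⟩
  | insert x S _ ih =>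
    obtain ⟨D', hD'⟩ := ih
    obtain ⟨D'', h, hx⟩ := D'.exists_refinement x
    refine ⟨D'', ?_⟩
    rw [Finset.coe_insert]
    exact Set.insert_subset hx (hD'.trans h)

theorem infinite (D : BlockDrawing X) [Nonempty X] : Infinite X := by
  obtain ⟨a⟩ : Nonempty D.W := by
    obtain ⟨x⟩ := ‹Nonempty X›
    rcases D.isDrawing.cover x with ⟨c, -⟩ | ⟨e, -, -⟩
    exacts [⟨c⟩, ⟨(Quot.out e).1⟩]
  obtain ⟨b, hb, -⟩ := D.isBlock.exists_third a a
  obtain ⟨p, -, ⟨h, -, -, -⟩⟩ := D.isBlock.exists_isPathPair hb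
  obtain ⟨γ, hγ, -⟩ := D.isDrawing.isArc_drawn p h hb
  exact Infinite.of_injective γ hγ

theorem exists_path_through (D : BlockDrawing X) {x y z : X} (hxy : x ≠ y) (hyz : y ≠ z)
    (hxz : x ≠ z) : ∃ γ : _root_.Path x z, Function.Injective γ ∧
      γ ⟨1 / 2, by norm_num, by norm_num⟩ = y := by
  classical
  obtain ⟨D, hD⟩ := D.exists_subset_range {x, y, z}
  obtain ⟨a, rfl⟩ := hD (show x ∈ _ by simp)
  obtain ⟨b, rfl⟩ := hD (show y ∈ _ by simp)
  obtain ⟨c, rfl⟩ := hD (show z ∈ _ by simp)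
  exact D.isDrawing.exists_path_through D.isBlock (ne_of_apply_ne _ hxy) (ne_of_apply_ne _ hyz)
    (ne_of_apply_ne _ hxz)

variable [T2Space X]

theorem exists_isCircleIn (D : BlockDrawing X) {x y : X} (hxy : x ≠ y) :
    ∃ C : Set X, IsCircleIn C ∧ x ∈ C ∧ y ∈ C := by
  classical
  obtain ⟨D, hD⟩ := D.exists_subset_range {x, y}
  obtain ⟨a, rfl⟩ := hD (show x ∈ _ by simp)
  obtain ⟨b, rfl⟩ := hD (show y ∈ _ by simp)
  exact D.isDrawing.exists_isCircleIn D.isBlock (ne_of_apply_ne _ hxy)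

theorem exists_circle_or_theta_of_ne (D : BlockDrawing X) {x y : X} (hxy : x ≠ y) (z : X) :
    ∃ T : Set X, (IsCircleIn T ∨ IsThetaCurveIn T) ∧ x ∈ T ∧ y ∈ T ∧ z ∈ T := by
  classical
  obtain ⟨D, hD⟩ := D.exists_subset_range {x, y, z}
  obtain ⟨a, rfl⟩ := hD (show x ∈ _ by simp)
  obtain ⟨b, rfl⟩ := hD (show y ∈ _ by simp)
  obtain ⟨c, rfl⟩ := hD (show z ∈ _ by simp)
  exact D.isDrawing.exists_circle_or_theta D.isBlock (ne_of_apply_ne _ hxy) c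

theorem exists_circle_or_theta (D : BlockDrawing X) [Infinite X] (x y z : X) :
    ∃ T : Set X, (IsCircleIn T ∨ IsThetaCurveIn T) ∧ x ∈ T ∧ y ∈ T ∧ z ∈ T := by
  by_cases hxy : x = y
  · subst hxy
    by_cases hxz : x = z
    · subst hxz
      obtain ⟨w, hw⟩ := exists_ne x
      obtain ⟨C, hC, -, hx⟩ := D.exists_isCircleIn hw
      exact ⟨C, .inl hC, hx, hx, hx⟩
    · obtain ⟨C, hC, hx, hz⟩ := D.exists_isCircleIn hxz
      exact ⟨C, .inl hC, hx, hx, hz⟩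
  · exact D.exists_circle_or_theta_of_ne hxy z

theorem isNCc_two (D : BlockDrawing X) [Infinite X] : IsNCc X 2 := by
  classical
  intro S hS
  obtain ⟨T, hST, hT⟩ := Infinite.exists_superset_card_eq S 2 hS
  obtain ⟨x, y, hxy, rfl⟩ := Finset.card_eq_two.1 hT
  obtain ⟨C, hC, hx, hy⟩ := D.exists_isCircleIn hxy
  refine ⟨C, hC, (Finset.coe_subset.2 hST).trans ?_⟩
  rintro w hw
  rcases (by simpa using hw : w = x ∨ w = y) with rfl | rfl
  exacts [hx, hy]

theorem isNSac_three (D : BlockDrawing X) [Infinite X] : IsNSac X 3 := by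
  have h3 : ∀ x : Fin 3 → X, Function.Injective x → ∃ α : unitInterval → X,
      Topology.IsEmbedding α ∧ ∃ t : Fin 3 → unitInterval, StrictMono t ∧ ∀ i, α (t i) = x i := by
    intro x hx
    obtain ⟨γ, hγ, hy⟩ := D.exists_path_through (hx.ne (show (0 : Fin 3) ≠ 1 by decide))
      (hx.ne (show (1 : Fin 3) ≠ 2 by decide)) (hx.ne (show (0 : Fin 3) ≠ 2 by decide))
    refine ⟨γ, (γ.continuous.isClosedEmbedding hγ).isEmbedding,
      ![0, ⟨1 / 2, by norm_num, by norm_num⟩, 1], ?_, ?_⟩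
    · rw [Fin.strictMono_iff_lt_succ]
      intro i
      fin_cases i
      · exact Subtype.mk_lt_mk.2 (by norm_num)
      · exact Subtype.mk_lt_mk.2 (by norm_num)
    · intro i
      fin_cases i
      exacts [γ.source, hy, γ.target]
  -- Shorter lists are extended by a further point, which exists since `X` is infinite, and the
  -- parameter of that point is forgotten afterwards.
  have hstep : ∀ m, (∀ x : Fin (m + 1) → X, Function.Injective x → ∃ α : unitInterval → X,
      Topology.IsEmbedding α ∧ ∃ t : Fin (m + 1) → unitInterval,
        StrictMono t ∧ ∀ i, α (t i) = x i) →
      ∀ x : Fin m → X, Function.Injective x → ∃ α : unitInterval → X,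
        Topology.IsEmbedding α ∧ ∃ t : Fin m → unitInterval,
          StrictMono t ∧ ∀ i, α (t i) = x i := by
    intro m hm x hx
    obtain ⟨y, hy⟩ := (Set.finite_range x).exists_notMem
    obtain ⟨α, hα, t, ht, htx⟩ := hm (Fin.snoc x y) (Fin.snoc_injective_iff.2 ⟨hx, hy⟩)
    refine ⟨α, hα, t ∘ Fin.castSucc, ht.comp Fin.strictMono_castSucc, fun i => ?_⟩
    rw [Function.comp_apply, htx, Fin.snoc_castSucc]
  intro m hm
  have h2 := hstep 2 h3
  have h1 := hstep 1 h2
  have h0 := hstep 0 h1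
  interval_cases m
  exacts [h0, h1, h2, h3]

end BlockDrawing

/-! ### The 1-complex: continuous functions, the Hausdorff property, and its drawing. -/

namespace OneComplex

variable {V : Type u} (G : SimpleGraph V)

/-- The point of `|G|` given by a vertex. -/
def vertexPt (v : V) : G.OneComplex := Quot.mk _ (Sum.inl v)

variable {G}

/-- The point of `|G|` at position `t` of an edge. -/
def edgePt (e : G.edgeSet) (t : unitInterval) : G.OneComplex := Quot.mk _ (Sum.inr ⟨e, t⟩)

/-- The first end of an edge. -/
noncomputable def source (e : G.edgeSet) : V := (Quot.out e.1).1

/-- The second end of an edge. -/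
noncomputable def target (e : G.edgeSet) : V := (Quot.out e.1).2

theorem mk_source_target (e : G.edgeSet) : s(source e, target e) = e.1 := Quot.out_eq e.1

theorem adj_source_target (e : G.edgeSet) : G.Adj (source e) (target e) := by
  rw [← mem_edgeSet, mk_source_target]
  exact e.2

theorem edgePt_zero (e : G.edgeSet) : edgePt e 0 = vertexPt G (source e) :=
  (Quot.sound (Glue.source e)).symm

theorem edgePt_one (e : G.edgeSet) : edgePt e 1 = vertexPt G (target e) :=
  (Quot.sound (Glue.target e)).symm

theorem continuous_edgePt (e : G.edgeSet) : Continuous (edgePt e) := by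
  let _ : TopologicalSpace V := ⊥
  exact continuous_quot_mk.comp
    (continuous_inr.comp (continuous_sigmaMk (σ := fun _ : G.edgeSet => unitInterval)) :
      Continuous fun t : unitInterval => (Sum.inr ⟨e, t⟩ : V ⊕ (Σ _ : G.edgeSet, unitInterval)))

theorem exists_eq (x : G.OneComplex) : (∃ v, vertexPt G v = x) ∨ ∃ e t, edgePt e t = x := by
  obtain ⟨v | ⟨e, t⟩, rfl⟩ := Quot.exists_rep x
  exacts [.inl ⟨v, rfl⟩, .inr ⟨e, t, rfl⟩]

/-- A function on `|G|` given by its values on the vertices and the edges. -/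
noncomputable def lift {Y : Type*} (φ : V → Y) (g : G.edgeSet → unitInterval → Y)
    (h0 : ∀ e, φ (source e) = g e 0) (h1 : ∀ e, φ (target e) = g e 1) : G.OneComplex → Y :=
  Quot.lift (Sum.elim φ fun p => g p.1 p.2) fun a b h => by
    cases h
    exacts [h0 _, h1 _]

theorem continuous_lift {Y : Type*} [TopologicalSpace Y] {φ : V → Y}
    {g : G.edgeSet → unitInterval → Y} (h0 : ∀ e, φ (source e) = g e 0)
    (h1 : ∀ e, φ (target e) = g e 1) (hg : ∀ e, Continuous (g e)) :
    Continuous (lift φ g h0 h1) := by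
  let _ : TopologicalSpace V := ⊥
  have : DiscreteTopology V := ⟨rfl⟩
  exact continuous_quot_lift _ (continuous_sumElim.2 ⟨continuous_of_discreteTopology,
    continuous_sigma hg⟩ :
      Continuous (Sum.elim φ fun p : (Σ _ : G.edgeSet, unitInterval) => g p.1 p.2))

/-- The extension of a real function on the vertices that is linear on every edge. -/
noncomputable def linearExtension (φ : V → ℝ) : G.OneComplex → ℝ :=
  lift φ (fun e t => (1 - t) * φ (source e) + t * φ (target e)) (by simp) (by simp)

theorem continuous_linearExtension (φ : V → ℝ) : Continuous (linearExtension (G := G) φ) :=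
  continuous_lift _ _ fun e => by fun_prop

theorem linearExtension_vertexPt (φ : V → ℝ) (v : V) :
    linearExtension φ (vertexPt G v) = φ v := rfl

theorem linearExtension_edgePt (φ : V → ℝ) (e : G.edgeSet) (t : unitInterval) :
    linearExtension φ (edgePt e t) = (1 - t) * φ (source e) + t * φ (target e) := rfl

open Classical in
/-- A function that vanishes outside an edge. -/
noncomputable def bump (e : G.edgeSet) (g : unitInterval → ℝ) (h0 : g 0 = 0) (h1 : g 1 = 0) :
    G.OneComplex → ℝ :=
  lift 0 (fun f => if f = e then g else 0)
    (fun f => by by_cases h : f = e <;> simp [h, h0])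
    (fun f => by by_cases h : f = e <;> simp [h, h1])

theorem continuous_bump (e : G.edgeSet) {g : unitInterval → ℝ} (h0 : g 0 = 0) (h1 : g 1 = 0)
    (hg : Continuous g) : Continuous (bump e g h0 h1) :=
  continuous_lift _ _ fun f => by
    by_cases h : f = e
    · simpa [h] using hg
    · simp only [if_neg h]
      exact continuous_zero

theorem bump_vertexPt (e : G.edgeSet) {g : unitInterval → ℝ} (h0 : g 0 = 0) (h1 : g 1 = 0)
    (v : V) : bump e g h0 h1 (vertexPt G v) = 0 := rfl

theorem bump_edgePt (e : G.edgeSet) {g : unitInterval → ℝ} (h0 : g 0 = 0) (h1 : g 1 = 0)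
    (t : unitInterval) : bump e g h0 h1 (edgePt e t) = g t := by
  classical
  change (if e = e then g else 0) t = g t
  rw [if_pos rfl]

theorem bump_edgePt_of_ne {e f : G.edgeSet} (h : f ≠ e) {g : unitInterval → ℝ} (h0 : g 0 = 0)
    (h1 : g 1 = 0) (t : unitInterval) : bump e g h0 h1 (edgePt f t) = 0 := by
  classical
  change (if f = e then g else 0) t = 0
  rw [if_neg h]
  rfl

theorem vertexPt_injective : Function.Injective (vertexPt G) := by
  classical
  intro v w h
  have := congrArg (linearExtension fun u => if u = v then 1 else 0) h
  rw [linearExtension_vertexPt, linearExtension_vertexPt] at this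
  by_contra hvw
  simp [Ne.symm hvw] at this

theorem edgePt_injective (e : G.edgeSet) : Function.Injective (edgePt e) := by
  classical
  intro s t h
  have := congrArg (linearExtension fun u => if u = source e then 1 else 0) h
  rw [linearExtension_edgePt, linearExtension_edgePt] at this
  simp only [if_neg (adj_source_target e).ne', if_true] at this
  exact Subtype.ext (by linarith)

theorem eq_zero_or_one_of_mul_eq_zero {t : unitInterval} (h : (t : ℝ) * (1 - t) = 0) :
    t = 0 ∨ t = 1 := by
  rcases mul_eq_zero.1 h with h | h
  · exact .inl (Subtype.ext h)
  · exact .inr (Subtype.ext (by rw [Set.Icc.coe_one]; linarith))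

theorem eq_vertexPt_of_mul_eq_zero (e : G.edgeSet) {t : unitInterval}
    (h : (t : ℝ) * (1 - t) = 0) : ∃ c ∈ e.1, vertexPt G c = edgePt e t := by
  have hmem : ∀ c, c ∈ e.1 ↔ c ∈ s(source e, target e) := fun c => by rw [mk_source_target]
  rcases eq_zero_or_one_of_mul_eq_zero h with rfl | rfl
  · exact ⟨source e, (hmem _).2 (by simp), (edgePt_zero e).symm⟩
  · exact ⟨target e, (hmem _).2 (by simp), (edgePt_one e).symm⟩

/-- The points of an edge that also belong to another edge or are vertices. -/
theorem mul_eq_zero_of_edgePt_eq {e f : G.edgeSet} (hef : f ≠ e) {s t : unitInterval}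
    (h : edgePt e s = edgePt f t) : (s : ℝ) * (1 - s) = 0 := by
  have := congrArg (bump e (fun t => (t : ℝ) * (1 - t)) (by simp) (by simp)) h
  rwa [bump_edgePt, bump_edgePt_of_ne hef] at this

/-- Vertices are separated by the linear extension of an indicator function. The bump `t (1 - t)`
separates an inner point of an edge from the vertices and from the points of other edges. For two
points of one edge it is combined with `t² (1 - t)`, as the quotient of the two bumps recovers `t`.
-/
theorem exists_continuous_ne {x y : G.OneComplex} (hxy : x ≠ y) :
    ∃ f : G.OneComplex → ℝ, Continuous f ∧ f x ≠ f y := by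
  classical
  by_contra! H
  have hvert : ∀ (v : V) (y : G.OneComplex), vertexPt G v ≠ y →
      ∃ f : G.OneComplex → ℝ, Continuous f ∧ f (vertexPt G v) ≠ f y := by
    intro v y hy
    by_contra! H
    rcases exists_eq y with ⟨w, rfl⟩ | ⟨e, t, rfl⟩
    · have := H _ (continuous_linearExtension fun u => if u = v then 1 else 0)
      rw [linearExtension_vertexPt, linearExtension_vertexPt] at this
      exact hy (congrArg _ (by simpa using this : w = v).symm)
    · have h := H (bump e (fun t => (t : ℝ) * (1 - t)) (by simp) (by simp))
        (continuous_bump _ _ _ (by fun_prop))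
      rw [bump_edgePt, bump_vertexPt] at h
      obtain ⟨c, -, hc⟩ := eq_vertexPt_of_mul_eq_zero e h.symm
      rw [← hc] at H hy
      have := H _ (continuous_linearExtension fun u => if u = v then 1 else 0)
      rw [linearExtension_vertexPt, linearExtension_vertexPt] at this
      exact hy (congrArg _ (by simpa using this : c = v).symm)
  have hx : ∀ v, vertexPt G v ≠ x := by
    rintro v rfl
    obtain ⟨f, hf, hne⟩ := hvert v y hxy
    exact hne (H f hf)
  have hy : ∀ v, vertexPt G v ≠ y := by
    rintro v rfl
    obtain ⟨f, hf, hne⟩ := hvert v x hxy.symm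
    exact hne (H f hf).symm
  obtain ⟨e, s, rfl⟩ := (exists_eq x).resolve_left fun ⟨v, hv⟩ => hx v hv
  obtain ⟨f, t, rfl⟩ := (exists_eq y).resolve_left fun ⟨v, hv⟩ => hy v hv
  have hs : (s : ℝ) * (1 - s) ≠ 0 := fun h => by
    obtain ⟨c, -, hc⟩ := eq_vertexPt_of_mul_eq_zero e h
    exact hx c hc
  have h1 := H (bump e (fun t => (t : ℝ) * (1 - t)) (by simp) (by simp))
    (continuous_bump _ _ _ (by fun_prop))
  have h2 := H (bump e (fun t => (t : ℝ) * (t * (1 - t))) (by simp) (by simp))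
    (continuous_bump _ _ _ (by fun_prop))
  by_cases hef : f = e
  · subst hef
    rw [bump_edgePt, bump_edgePt] at h1 h2
    rw [← h1] at h2
    exact hxy (congrArg _ (Subtype.ext (mul_right_cancel₀ hs h2)))
  · rw [bump_edgePt, bump_edgePt_of_ne hef] at h1
    exact hs h1

instance : T2Space G.OneComplex :=
  ⟨fun _ _ hxy => by
    obtain ⟨_, hf, hne⟩ := exists_continuous_ne hxy
    exact separated_by_continuous hf hne⟩

/-- The arc of `|G|` that belongs to an edge. -/
def edgeArc (G : SimpleGraph V) (e : Sym2 V) : Set G.OneComplex :=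
  {x | ∃ (h : e ∈ G.edgeSet) (t : unitInterval), edgePt ⟨e, h⟩ t = x}

theorem isArc_edgeArc (e : G.edgeSet) :
    IsArc (edgeArc G e.1) (vertexPt G (source e)) (vertexPt G (target e)) := by
  refine ⟨⟨⟨edgePt e, continuous_edgePt e⟩, edgePt_zero e, edgePt_one e⟩, edgePt_injective e, ?_⟩
  ext x
  exact ⟨fun ⟨t, ht⟩ => ⟨e.2, t, ht⟩, fun ⟨_, t, ht⟩ => ⟨t, ht⟩⟩

variable (G) in
-- A bump on one edge vanishes on every other edge, so a common point of two edges is an end of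
-- each, and the two ends agree because vertices are distinct points.
theorem isDrawing : G.IsDrawing (vertexPt G) (edgeArc G) := by
  refine ⟨vertexPt_injective, fun {a b} hab => ?_, ?_, ?_⟩
  · have h := isArc_edgeArc ⟨s(a, b), hab⟩
    -- The chosen orientation of the edge may run from `b` to `a`.
    rcases Sym2.eq_iff.1 (mk_source_target ⟨s(a, b), hab⟩) with ⟨h1, h2⟩ | ⟨h1, h2⟩
    · rwa [h1, h2] at h
    · rw [h1, h2] at h
      exact h.symm
  · rintro e f he hf hef _ ⟨_, s, rfl⟩ ⟨_, t, hst⟩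
    have hne : (⟨e, he⟩ : G.edgeSet) ≠ ⟨f, hf⟩ := fun h => hef (congrArg Subtype.val h)
    obtain ⟨c, hc, h1⟩ := eq_vertexPt_of_mul_eq_zero _ (mul_eq_zero_of_edgePt_eq hne.symm hst.symm)
    obtain ⟨d, hd, h2⟩ := eq_vertexPt_of_mul_eq_zero _ (mul_eq_zero_of_edgePt_eq hne hst)
    obtain rfl := vertexPt_injective (h1.trans (hst.symm.trans h2.symm))
    exact ⟨c, hc, hd, h1⟩
  · intro x
    exact (exists_eq x).imp id fun ⟨e, t, h⟩ => ⟨e.1, e.2, e.2, t, h⟩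

end OneComplex

/-- The 1-complex of a block, drawn by its vertices and edges. -/
noncomputable def IsBlock.blockDrawing {V : Type u} {G : SimpleGraph V} (hG : G.IsBlock) :
    BlockDrawing G.OneComplex :=
  ⟨hG, OneComplex.isDrawing G⟩

end SimpleGraph

/-! ### The topological conditions exclude cut points. -/

section NoCutPoints

/-- No point separates two others. -/
def NoCutPoints (X : Type*) [TopologicalSpace X] : Prop :=
  ∀ x y z : X, y ≠ x → z ≠ x → JoinedIn {x}ᶜ y z

variable {X : Type u} [TopologicalSpace X]

theorem joinedIn_compl_of_forall_uIcc {α : unitInterval → X} (hα : Continuous α)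
    {s t : unitInterval} {x : X} (h : ∀ r ∈ Set.uIcc s t, α r ≠ x) :
    JoinedIn {x}ᶜ (α s) (α t) := by
  let γ : Path (α 0) (α 1) := ⟨⟨α, hα⟩, rfl, rfl⟩
  refine ⟨γ.subpath s t, fun r hr => ?_⟩
  have : γ.subpath s t r ∈ γ '' Set.uIcc s t := by
    rw [← Path.range_subpath]
    exact ⟨r, rfl⟩
  obtain ⟨q, hq, hqr⟩ := this
  exact h q hq (hqr.trans hr)

/-- The point to be avoided is put last: on an arc through `y`, `z`, `x` in this order, the piece
from `y` to `z` misses `x`. -/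
theorem IsNSac.noCutPoints (h : IsNSac X 3) : NoCutPoints X := by
  intro x y z hy hz
  by_cases hyz : y = z
  · subst hyz
    exact JoinedIn.refl hy
  obtain ⟨α, hα, t, ht, htx⟩ := h 3 le_rfl ![y, z, x] (by
    intro i j
    fin_cases i <;> fin_cases j <;> simp [hy, hz, hyz, hy.symm, hz.symm, Ne.symm hyz])
  have h0 : α (t 0) = y := htx 0
  have h1 : α (t 1) = z := htx 1
  have h2 : α (t 2) = x := htx 2
  rw [← h0, ← h1]
  refine joinedIn_compl_of_forall_uIcc hα.continuous fun r hr hrx => ?_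
  have hr2 : r = t 2 := hα.injective (hrx.trans h2.symm)
  rw [Set.uIcc_of_le (ht.monotone (show (0 : Fin 3) ≤ 1 by decide)), hr2] at hr
  exact absurd (ht (show (1 : Fin 3) < 2 by decide)) (not_lt.2 hr.2)

theorem AddCircle.noCutPoints : NoCutPoints (AddCircle (1 : ℝ)) := by
  intro x y z hy hz
  obtain ⟨a, rfl⟩ := QuotientAddGroup.mk_surjective x
  have hrep : ∀ y : AddCircle (1 : ℝ), y ≠ (a : AddCircle (1 : ℝ)) →
      y ∈ ((↑) : ℝ → AddCircle (1 : ℝ)) '' Set.Ioo a (a + 1) := by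
    intro y hy
    have : y ∈ ((↑) : ℝ → AddCircle (1 : ℝ)) '' Set.Ico a (a + 1) := by
      rw [AddCircle.coe_image_Ico_eq]
      trivial
    obtain ⟨s, hs, rfl⟩ := this
    exact ⟨s, ⟨lt_of_le_of_ne hs.1 (by rintro rfl; exact hy rfl), hs.2⟩, rfl⟩
  have hpc : IsPathConnected (((↑) : ℝ → AddCircle (1 : ℝ)) '' Set.Ioo a (a + 1)) :=
    ((convex_Ioo a (a + 1)).isPathConnected (Set.nonempty_Ioo.2 (by linarith))).image
      (AddCircle.continuous_mk' 1)
  refine (hpc.joinedIn y (hrep y hy) z (hrep z hz)).mono ?_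
  rintro _ ⟨s, hs, rfl⟩ hsa
  have := (AddCircle.coe_eq_coe_iff_of_mem_Ico (p := (1 : ℝ)) (a := a) ⟨hs.1.le, hs.2⟩
    ⟨le_rfl, by linarith⟩).1 hsa
  exact hs.1.ne' this

instance : Infinite (AddCircle (1 : ℝ)) :=
  (AddCircle.equivIco (1 : ℝ) 0).infinite_iff.2 (Set.infinite_coe_iff.2 (Set.Ico_infinite (by simp)))

theorem IsCircleIn.infinite {C : Set X} (h : IsCircleIn C) : Infinite X := by
  obtain ⟨φ⟩ := h
  have : Infinite C :=
    (φ.trans (AddCircle.homeomorphCircle one_ne_zero).symm).toEquiv.infinite_iff.2 inferInstance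
  exact Infinite.of_injective ((↑) : C → X) Subtype.val_injective

theorem IsCircleIn.joinedIn {C : Set X} (h : IsCircleIn C) {x y z : X} (hyC : y ∈ C) (hzC : z ∈ C)
    (hy : y ≠ x) (hz : z ≠ x) : JoinedIn {x}ᶜ y z := by
  classical
  obtain ⟨φ⟩ := h
  let ψ : C ≃ₜ AddCircle (1 : ℝ) := φ.trans (AddCircle.homeomorphCircle one_ne_zero).symm
  -- If `x` is not on the circle, any point other than the images of `y` and `z` can be removed
  -- instead.
  obtain ⟨w, hwx, hwy, hwz⟩ : ∃ w, (∀ h : x ∈ C, ψ ⟨x, h⟩ = w) ∧ ψ ⟨y, hyC⟩ ≠ w ∧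
      ψ ⟨z, hzC⟩ ≠ w := by
    by_cases hx : x ∈ C
    · exact ⟨ψ ⟨x, hx⟩, fun _ => rfl, ψ.injective.ne fun h => hy (congrArg Subtype.val h),
        ψ.injective.ne fun h => hz (congrArg Subtype.val h)⟩
    · obtain ⟨w, hw⟩ := Infinite.exists_notMem_finset {ψ ⟨y, hyC⟩, ψ ⟨z, hzC⟩}
      simp only [Finset.mem_insert, Finset.mem_singleton, not_or] at hw
      exact ⟨w, fun h => absurd h hx, Ne.symm hw.1, Ne.symm hw.2⟩
  obtain ⟨γ, hγ⟩ := AddCircle.noCutPoints w _ _ hwy hwz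
  refine ⟨(γ.map (continuous_subtype_val.comp ψ.symm.continuous)).cast (by simp) (by simp),
    fun t ht => hγ t ?_⟩
  have ht' : ((ψ.symm (γ t) : C) : X) = x := ht
  have hx : x ∈ C := ht' ▸ (ψ.symm (γ t)).2
  have : ψ.symm (γ t) = ⟨x, hx⟩ := Subtype.ext ht'
  rw [Set.mem_singleton_iff, ← hwx hx, ← this, Homeomorph.apply_symm_apply]

theorem IsThetaCurveIn.infinite {T : Set X} (h : IsThetaCurveIn T) : Infinite X := by
  obtain ⟨a, b, p, -, hp, -, -⟩ := h
  exact Infinite.of_injective (p 0) (hp 0).1.injective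

/-- From any point other than `x` one can move along its own arc, away from `x`, to one of the
branch points. If both branch points differ from `x`, then `x` lies on at most one of the three
arcs, and another arc joins the branch points. -/
theorem IsThetaCurveIn.joinedIn {T : Set X} (h : IsThetaCurveIn T) {x y z : X} (hyT : y ∈ T)
    (hzT : z ∈ T) (hy : y ≠ x) (hz : z ≠ x) : JoinedIn {x}ᶜ y z := by
  obtain ⟨a, b, p, -, hp, hinter, rfl⟩ := h
  have hends : ∀ y ∈ ⋃ i, Set.range (p i), y ≠ x →
      (a ≠ x ∧ JoinedIn {x}ᶜ y a) ∨ (b ≠ x ∧ JoinedIn {x}ᶜ y b) := by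
    intro y hyT hy
    obtain ⟨i, s, rfl⟩ := Set.mem_iUnion.1 hyT
    obtain ⟨hpi, h0, h1⟩ := hp i
    by_cases hx : x ∈ Set.range (p i)
    · obtain ⟨r, rfl⟩ := hx
      rcases lt_or_gt_of_ne (fun h : s = r => hy (congrArg _ h)) with hsr | hsr
      · have hJ : JoinedIn {p i r}ᶜ (p i s) (p i 0) :=
          joinedIn_compl_of_forall_uIcc hpi.continuous fun q hq hqr => by
            rw [Set.uIcc_of_ge unitInterval.nonneg', hpi.injective hqr] at hq
            exact absurd hsr (not_lt.2 hq.2)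
        rw [h0] at hJ
        exact .inl ⟨hJ.target_mem, hJ⟩
      · have hJ : JoinedIn {p i r}ᶜ (p i s) (p i 1) :=
          joinedIn_compl_of_forall_uIcc hpi.continuous fun q hq hqr => by
            rw [Set.uIcc_of_le unitInterval.le_one', hpi.injective hqr] at hq
            exact absurd hsr (not_lt.2 hq.1)
        rw [h1] at hJ
        exact .inr ⟨hJ.target_mem, hJ⟩
    · have hJ : JoinedIn {x}ᶜ (p i s) (p i 0) :=
        joinedIn_compl_of_forall_uIcc hpi.continuous fun q _ hqx => hx ⟨q, hqx⟩
      rw [h0] at hJ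
      exact .inl ⟨hJ.target_mem, hJ⟩
  have hab : a ≠ x → b ≠ x → JoinedIn {x}ᶜ a b := by
    intro ha hb
    obtain ⟨i, hi⟩ : ∃ i, x ∉ Set.range (p i) := by
      by_contra! H
      have : x ∈ ({a, b} : Set X) := hinter 0 1 (by decide) ▸ ⟨H 0, H 1⟩
      exact this.elim (fun h => ha h.symm) fun h => hb h.symm
    rw [← (hp i).2.1, ← (hp i).2.2]
    exact joinedIn_compl_of_forall_uIcc (hp i).1.continuous fun q _ hqx => hi ⟨q, hqx⟩
  rcases hends y hyT hy with ⟨ha, hya⟩ | ⟨hb, hyb⟩ <;>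
    rcases hends z hzT hz with ⟨ha', hza⟩ | ⟨hb', hzb⟩
  · exact hya.trans hza.symm
  · exact (hya.trans (hab ha hb')).trans hzb.symm
  · exact (hyb.trans (hab ha' hb).symm).trans hza.symm
  · exact hyb.trans hzb.symm

theorem IsNCc.noCutPoints (h : IsNCc X 2) : NoCutPoints X := by
  classical
  intro x y z hy hz
  obtain ⟨C, hC, hS⟩ := h {y, z} Finset.card_le_two
  exact hC.joinedIn (hS (by simp)) (hS (by simp)) hy hz

theorem false_of_joinedIn_of_sign_change {f : X → ℝ} (hf : Continuous f) {x y z : X}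
    (h : JoinedIn {x}ᶜ y z) (hy : 0 < f y) (hz : f z < 0) (hx : ∀ w, f w = 0 → w = x) : False := by
  obtain ⟨γ, hγ⟩ := h
  have h0 : (0 : ℝ) ∈ Set.range (f ∘ γ) :=
    mem_range_of_exists_le_of_exists_ge (hf.comp γ.continuous) ⟨1, by simpa using hz.le⟩
      ⟨0, by simpa using hy.le⟩
  obtain ⟨t, ht⟩ := h0
  exact hγ t (hx _ ht)

end NoCutPoints

/-! ### A graph whose 1-complex is infinite and has no cut points is a block. -/

namespace SimpleGraph

open OneComplex

variable {V : Type u} {G : SimpleGraph V}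

/-- If `w` separated `a` from `b`, consider the function that is `0` at `w`, `1` on the vertices
reachable from `a` without `w`, and `-1` elsewhere. It is constant along edges that miss `w`, so its
linear extension vanishes only at `w` but changes sign between `a` and `b`. -/
theorem exists_avoiding_of_noCutPoints (h : NoCutPoints G.OneComplex) {w a b : V} (ha : a ≠ w)
    (hb : b ≠ w) : ∃ p : G.Walk a b, w ∉ p.support := by
  classical
  by_contra H
  let R : V → Prop := fun c => ∃ p : G.Walk a c, w ∉ p.support
  have hR : ∀ {c d}, G.Adj c d → d ≠ w → R c → R d := by
    rintro c d hcd hd ⟨p, hp⟩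
    refine ⟨p.concat hcd, ?_⟩
    rw [Walk.support_concat, List.mem_append, List.mem_singleton, not_or]
    exact ⟨hp, hd.symm⟩
  let φ : V → ℝ := fun c => if c = w then 0 else if R c then 1 else -1
  have hφw : φ w = 0 := if_pos rfl
  have hφ : ∀ c, c ≠ w → φ c ≠ 0 := by
    intro c hc
    simp only [φ, if_neg hc]
    split_ifs <;> norm_num
  have hφe : ∀ {c d}, G.Adj c d → c ≠ w → d ≠ w → φ c = φ d := by
    intro c d hcd hc hd
    have : R c ↔ R d := ⟨hR hcd hd, hR hcd.symm hc⟩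
    simp only [φ, if_neg hc, if_neg hd, this]
  refine false_of_joinedIn_of_sign_change (continuous_linearExtension φ)
    (h (vertexPt G w) (vertexPt G a) (vertexPt G b) (vertexPt_injective.ne ha)
      (vertexPt_injective.ne hb)) ?_ ?_ ?_
  · have : R a := ⟨.nil, by simpa using ha.symm⟩
    simp [linearExtension_vertexPt, φ, ha, this]
  · have : ¬ R b := H
    simp [linearExtension_vertexPt, φ, hb, this]
  · intro x hx
    rcases exists_eq x with ⟨v, rfl⟩ | ⟨e, t, rfl⟩
    · by_contra hv
      exact hφ v (fun h => hv (congrArg _ h)) hx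
    · rw [linearExtension_edgePt] at hx
      have hadj := adj_source_target e
      by_cases hs : source e = w
      · have hφt := hφ _ (hs ▸ hadj.ne')
        rw [hs, hφw, mul_zero, zero_add] at hx
        obtain rfl : t = 0 := Subtype.ext ((mul_eq_zero.1 hx).resolve_right hφt)
        rw [edgePt_zero, hs]
      · by_cases ht : target e = w
        · rw [ht, hφw, mul_zero, add_zero] at hx
          have h1 := (mul_eq_zero.1 hx).resolve_right (hφ _ hs)
          obtain rfl : t = 1 := Subtype.ext (by rw [Set.Icc.coe_one]; linarith)
          rw [edgePt_one, ht]
        · rw [← hφe hadj hs ht] at hx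
          exact absurd (by linarith) (hφ _ hs)

/-- With at most two vertices there is at most one edge. The function with values `1` at `a` and
`-1` at `b` extends linearly with a zero only at the midpoint of that edge, which is therefore a cut
point. Infinitude is essential: one or two isolated points have no cut points either. -/
theorem exists_third_of_noCutPoints [Infinite G.OneComplex] (h : NoCutPoints G.OneComplex)
    (a b : V) : ∃ c, c ≠ a ∧ c ≠ b := by
  classical
  by_contra! H
  have hends : ∀ e : G.edgeSet, e.1 = s(a, b) := by
    intro e
    have hadj := (adj_source_target e).ne
    rw [← mk_source_target e]
    by_cases hs : source e = a
    · rw [H (target e) (hs ▸ hadj.symm), hs]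
    · by_cases ht : target e = a
      · rw [H _ hs, ht, Sym2.eq_swap]
      · exact absurd ((H _ hs).trans (H _ ht).symm) hadj
  by_cases hab : a = b
  · subst hab
    obtain ⟨x, hx⟩ := exists_ne (vertexPt G a)
    rcases exists_eq x with ⟨v, rfl⟩ | ⟨e, -, -⟩
    · by_cases hv : v = a
      · exact hx (congrArg _ hv)
      · exact hv (H v hv)
    · have := e.2
      rw [hends e] at this
      exact G.irrefl this
  · let φ : V → ℝ := fun c => if c = a then 1 else -1
    have hφa : φ a = 1 := if_pos rfl
    have hφb : φ b = -1 := if_neg (Ne.symm hab)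
    have hzero : ∀ x, linearExtension (G := G) φ x = 0 →
        ∃ e : G.edgeSet, x = edgePt e ⟨1 / 2, by norm_num, by norm_num⟩ := by
      intro x hx
      rcases exists_eq x with ⟨v, rfl⟩ | ⟨e, t, rfl⟩
      · rw [linearExtension_vertexPt] at hx
        simp only [φ] at hx
        split_ifs at hx <;> norm_num at hx
      · refine ⟨e, congrArg _ (Subtype.ext ?_)⟩
        rw [linearExtension_edgePt] at hx
        change (t : ℝ) = 1 / 2
        rcases Sym2.eq_iff.1 ((mk_source_target e).trans (hends e)) with ⟨h1, h2⟩ | ⟨h1, h2⟩ <;>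
          rw [h1, h2, hφa, hφb] at hx <;> linarith
    obtain ⟨x, hxa, hxb, hx⟩ : ∃ x, vertexPt G a ≠ x ∧ vertexPt G b ≠ x ∧
        ∀ y, linearExtension (G := G) φ y = 0 → y = x := by
      by_cases he : Nonempty G.edgeSet
      · obtain ⟨e⟩ := he
        have hval : linearExtension φ (edgePt e ⟨1 / 2, by norm_num, by norm_num⟩) = 0 := by
          rw [linearExtension_edgePt]
          rcases Sym2.eq_iff.1 ((mk_source_target e).trans (hends e)) with ⟨h1, h2⟩ | ⟨h1, h2⟩ <;>
            rw [h1, h2, hφa, hφb] <;> norm_num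
        refine ⟨edgePt e ⟨1 / 2, by norm_num, by norm_num⟩, ?_, ?_, fun y hy => ?_⟩
        · intro h
          rw [← h, linearExtension_vertexPt, hφa] at hval
          norm_num at hval
        · intro h
          rw [← h, linearExtension_vertexPt, hφb] at hval
          norm_num at hval
        · obtain ⟨f, rfl⟩ := hzero y hy
          rw [Subtype.ext ((hends f).trans (hends e).symm)]
      -- Without edges the function has no zero at all, and any third point may serve as the point
      -- to be avoided.
      · obtain ⟨x, hx⟩ := Infinite.exists_notMem_finset {vertexPt G a, vertexPt G b}
        simp only [Finset.mem_insert, Finset.mem_singleton, not_or] at hx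
        refine ⟨x, Ne.symm hx.1, Ne.symm hx.2, fun y hy => ?_⟩
        obtain ⟨e, -⟩ := hzero y hy
        exact absurd ⟨e⟩ he
    refine false_of_joinedIn_of_sign_change (continuous_linearExtension φ) (h x _ _ hxa hxb) ?_ ?_ hx
    · rw [linearExtension_vertexPt, hφa]; norm_num
    · rw [linearExtension_vertexPt, hφb]; norm_num

theorem isBlock_of_noCutPoints [Infinite G.OneComplex] (h : NoCutPoints G.OneComplex) :
    G.IsBlock :=
  ⟨exists_third_of_noCutPoints h, fun _ _ _ ha hb => exists_avoiding_of_noCutPoints h ha hb⟩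

end SimpleGraph

theorem mainTheorem8 {V : Type u} [Nonempty V] (G : SimpleGraph V) :
    List.TFAE
      [IsNSac G.OneComplex 3,
       G.IsCyclicallyConnected,
       ∀ x y z : G.OneComplex, ∃ T : Set G.OneComplex,
         (IsCircleIn T ∨ IsThetaCurveIn T) ∧ x ∈ T ∧ y ∈ T ∧ z ∈ T,
       ¬ Nonempty (G ≃g SimpleGraph.completeGraph (Fin 2)) ∧ G.IsKConnected 2,
       IsNCc G.OneComplex 2] := by
  have hne : Nonempty G.OneComplex := ‹Nonempty V›.map (SimpleGraph.OneComplex.vertexPt G)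
  have hinf : G.IsBlock → Infinite G.OneComplex := fun hG => hG.blockDrawing.infinite
  tfae_have 2 → 1 := fun h => by
    have hG := h.isBlock
    have := hinf hG
    exact hG.blockDrawing.isNSac_three
  tfae_have 2 → 3 := fun h => by
    have hG := h.isBlock
    have := hinf hG
    exact hG.blockDrawing.exists_circle_or_theta
  tfae_have 2 → 5 := fun h => by
    have hG := h.isBlock
    have := hinf hG
    exact hG.blockDrawing.isNCc_two
  tfae_have 2 ↔ 4 :=
    SimpleGraph.isBlock_iff_isCyclicallyConnected.symm.trans SimpleGraph.isBlock_iff_isKConnected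
  tfae_have 1 → 2 := fun h => by
    -- The empty list already yields an arc, hence infinitely many points; likewise (3) for a
    -- repeated point and (5) for the empty set yield infinite curves below.
    obtain ⟨α, hα, -⟩ := h 0 (by norm_num) Fin.elim0 fun i => i.elim0
    have := Infinite.of_injective α hα.injective
    exact (SimpleGraph.isBlock_of_noCutPoints h.noCutPoints).isCyclicallyConnected
  tfae_have 3 → 2 := fun h => by
    obtain ⟨x⟩ := hne
    obtain ⟨T, hT, -⟩ := h x x x
    have : Infinite G.OneComplex := hT.elim IsCircleIn.infinite IsThetaCurveIn.infinite
    refine (SimpleGraph.isBlock_of_noCutPoints fun x y z hy hz => ?_).isCyclicallyConnected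
    obtain ⟨T, hT, hyT, hzT, -⟩ := h y z z
    exact hT.elim (fun hT => hT.joinedIn hyT hzT hy hz) fun hT => hT.joinedIn hyT hzT hy hz
  tfae_have 5 → 2 := fun h => by
    obtain ⟨C, hC, -⟩ := h ∅ (by simp)
    have := hC.infinite
    exact (SimpleGraph.isBlock_of_noCutPoints h.noCutPoints).isCyclicallyConnected
  tfae_finish
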